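/- Let $k\ge 0$ and $n\ge 2$. Write $S_m$ for the complex vector space of binary forms of degree $m$, identify $\mathbb{P}^n$ with the projective space $\mathbb{P}(S_n^\vee)$ whose points are the nonzero binary forms of degree $n$ up to scalars, and let $E_{n,n+k}$ be the Schwarzenberger bundle, the rank $n$ vector bundle on $\mathbb{P}^n$ defined by the exact sequence $$0\to S_k\otimes\mathcal{O}_{\mathbb{P}^n}(-1)\to S_{n+k}\otimes\mathcal{O}_{\mathbb{P}^n}\to E_{n,n+k}\to 0,$$ whose first map is the multiplication of binary forms. For $r\le n$ linearly independent sections $s_1,\dots,s_r\in H^0(\mathbb{P}^n,E_{n,n+k})$, the Poncelet variety defined by them is the closed subscheme $s_1\wedge\dots\wedge s_r=0$ of $\mathbb{P}^n$; its ideal is generated locally by the minors of order $k+1+r$ of the matrix formed by the $k+1$ columns of the multiplication map and by $r$ columns representing $s_1,\dots,s_r$. A Poncelet hypersurface is a hypersurface that is the Poncelet variety of $n$ linearly independent sections, i.e. its equation is the determinant of $n$ sections of $E_{n,n+k}$. Then a hypersurface $H\subset\mathbb{P}^n$ of degree $k+1$ (the closed subscheme defined by a nonzero form of degree $k+1$)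 is a Poncelet hypersurface if and only if it contains, as a closed subscheme, a Poncelet variety of codimension $2$ in $\mathbb{P}^n$ defined by $n-1$ linearly independent sections of $E_{n,n+k}$. -/

import Mathlib

noncomputable section

namespace Schwarzenberger

/-! ## Multiplication of binary forms and its cokernel over a ring -/

section Local

/-- The matrix, in the monomial bases, of the multiplication `S_k ⊗ A → S_{n+k} ⊗ A` by the binary
form of degree `n` with coefficients `x₀, …, xₙ` : a binary form of degree `m` is the vector of its
`m + 1` coefficients, and the entry `(i, l)` is `x_{i-l}` if `0 ≤ i - l ≤ n` and `0` otherwise. -/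
def multMatrix {A : Type*} [CommRing A] (n k : ℕ) (x : Fin (n + 1) → A) :
    Matrix (Fin (n + k + 1)) (Fin (k + 1)) A :=
  Matrix.of fun i l => ∑ j : Fin (n + 1), if (j : ℕ) + (l : ℕ) = (i : ℕ) then x j else 0

/-- The image of the multiplication `S_k ⊗ A → S_{n+k} ⊗ A`. -/
def relations {A : Type*} [CommRing A] (n k : ℕ) (x : Fin (n + 1) → A) :
    Submodule A (Fin (n + k + 1) → A) :=
  LinearMap.range (multMatrix n k x).mulVecLin

/-- The cokernel of the multiplication `S_k ⊗ A → S_{n+k} ⊗ A`. -/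
abbrev Coker {A : Type*} [CommRing A] (n k : ℕ) (x : Fin (n + 1) → A) : Type _ :=
  (Fin (n + k + 1) → A) ⧸ relations n k x

theorem multMatrix_map {A B : Type*} [CommRing A] [CommRing B] (n k : ℕ)
    (x : Fin (n + 1) → A) (y : Fin (n + 1) → B) (φ : A →+* B) (u : B)
    (h : ∀ j, φ (x j) = u * y j) :
    (multMatrix n k x).map φ = u • multMatrix n k y := by
  ext i l
  simp only [multMatrix, Matrix.map_apply, Matrix.of_apply, Matrix.smul_apply, map_sum,
    smul_eq_mul, Finset.mul_sum]
  refine Finset.sum_congr rfl fun j _ => ?_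
  split_ifs <;> simp [h]

/-- A ring homomorphism, applied to all coefficients of a vector. -/
def coeffMap {A B : Type*} [CommRing A] [CommRing B] (N : ℕ) (φ : A →+* B) :
    (Fin N → A) →ₛₗ[φ] (Fin N → B) where
  toFun v := fun i => φ (v i)
  map_add' v w := by ext i; simp
  map_smul' a v := by ext i; simp

theorem relations_le_comap {A B : Type*} [CommRing A] [CommRing B] (n k : ℕ)
    (x : Fin (n + 1) → A) (y : Fin (n + 1) → B) (φ : A →+* B) (u : B)
    (h : ∀ j, φ (x j) = u * y j) :
    relations n k x ≤ (relations n k y).comap (coeffMap (n + k + 1) φ) := by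
  rintro _ ⟨c, rfl⟩
  refine ⟨u • coeffMap (k + 1) φ c, ?_⟩
  have h2 := multMatrix_map n k x y φ u h
  ext i
  have h3 : ∀ l, φ (multMatrix n k x i l) = u * multMatrix n k y i l := fun l => by
    simpa using congrFun (congrFun h2 i) l
  simp only [Matrix.mulVecLin_apply, Matrix.mulVec, dotProduct, coeffMap, LinearMap.coe_mk,
    AddHom.coe_mk, map_sum, map_mul, h3, Pi.smul_apply, smul_eq_mul]
  exact Finset.sum_congr rfl fun l _ => by ring

/-- Base change of cokernels along `φ`, when the two coordinate vectors agree up to a factor. -/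
def cokerMap {A B : Type*} [CommRing A] [CommRing B] (n k : ℕ)
    (x : Fin (n + 1) → A) (y : Fin (n + 1) → B) (φ : A →+* B) (u : B)
    (h : ∀ j, φ (x j) = u * y j) : Coker n k x →ₛₗ[φ] Coker n k y :=
  (relations n k x).mapQ (relations n k y) (coeffMap (n + k + 1) φ)
    (relations_le_comap n k x y φ u h)

/-- The matrix whose columns are those of the multiplication matrix, followed by `f₁, …, f_r`. -/
def bordered {A : Type*} [CommRing A] (n k r : ℕ) (x : Fin (n + 1) → A)
    (f : Fin r → Fin (n + k + 1) → A) :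
    Matrix (Fin (n + k + 1)) (Fin (k + 1) ⊕ Fin r) A :=
  Matrix.fromCols (multMatrix n k x) (Matrix.of f).transpose

/-- The ideal of the degeneracy locus `s₁ ∧ ⋯ ∧ s_r = 0` of `r` elements of the cokernel: it is
generated by the minors of order `k + 1 + r` of the matrix formed by the multiplication matrix and
by `r` vectors that represent `s₁, …, s_r` (for `r = n` there is one minor, up to sign: the
determinant). Replacing a representative by another one is a column operation. -/
def minorIdeal {A : Type*} [CommRing A] (n k r : ℕ) (x : Fin (n + 1) → A)
    (s : Fin r → Coker n k x) : Ideal A :=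
  Ideal.span {d : A | ∃ (f : Fin r → Fin (n + k + 1) → A)
    (e : Fin (k + 1) ⊕ Fin r → Fin (n + k + 1)),
      (∀ a, (Submodule.Quotient.mk (f a) : Coker n k x) = s a) ∧
      d = ((bordered n k r x f).submatrix e id).det}

/-- The minors do not depend on the chosen representatives. -/
theorem det_bordered_congr {A : Type*} [CommRing A] (n k r : ℕ) (x : Fin (n + 1) → A)
    (f g : Fin r → Fin (n + k + 1) → A)
    (h : ∀ a, (Submodule.Quotient.mk (f a) : Coker n k x) = Submodule.Quotient.mk (g a))
    (e : Fin (k + 1) ⊕ Fin r → Fin (n + k + 1)) :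
    ((bordered n k r x f).submatrix e id).det = ((bordered n k r x g).submatrix e id).det := by
  have h1 : ∀ a, ∃ c : Fin (k + 1) → A, (multMatrix n k x).mulVec c = f a - g a := fun a => by
    obtain ⟨c, hc⟩ := (Submodule.Quotient.eq (relations n k x)).1 (h a)
    exact ⟨c, by simpa using hc⟩
  choose c hc using h1
  let W : Matrix (Fin (k + 1) ⊕ Fin r) (Fin (k + 1) ⊕ Fin r) A :=
    Matrix.fromBlocks 1 (Matrix.of c).transpose 0 1
  have h2 : bordered n k r x f = bordered n k r x g * W := by
    rw [bordered, bordered, Matrix.fromCols_mul_fromBlocks]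
    ext i (l | a)
    · simp
    · have := congrFun (hc a) i
      simp only [Matrix.mulVec, dotProduct, Pi.sub_apply] at this
      simp [Matrix.mul_apply, this]
  have h3 : (bordered n k r x f).submatrix e id =
      (bordered n k r x g).submatrix e id * W := by
    rw [h2]; rfl
  rw [h3, Matrix.det_mul, Matrix.det_fromBlocks_zero₂₁]
  simp

/-- A base change multiplies the minors by a power of the factor between the two coordinate
vectors. -/
theorem det_bordered_map {A B : Type*} [CommRing A] [CommRing B] (n k r : ℕ)
    (x : Fin (n + 1) → A) (y : Fin (n + 1) → B) (φ : A →+* B) (u : B)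
    (h : ∀ j, φ (x j) = u * y j) (f : Fin r → Fin (n + k + 1) → A)
    (e : Fin (k + 1) ⊕ Fin r → Fin (n + k + 1)) :
    φ ((bordered n k r x f).submatrix e id).det =
      u ^ (k + 1) *
        ((bordered n k r y fun a => coeffMap (n + k + 1) φ (f a)).submatrix e id).det := by
  rw [RingHom.map_det]
  have h2 := multMatrix_map n k x y φ u h
  let W : Matrix (Fin (k + 1) ⊕ Fin r) (Fin (k + 1) ⊕ Fin r) B :=
    Matrix.fromBlocks (u • 1) 0 0 1
  have h3 : φ.mapMatrix ((bordered n k r x f).submatrix e id) =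
      ((bordered n k r y fun a => coeffMap (n + k + 1) φ (f a)).submatrix e id) * W := by
    have : (bordered n k r y fun a => coeffMap (n + k + 1) φ (f a)) * W = (bordered n k r x f).map φ := by
      rw [bordered, bordered, Matrix.fromCols_mul_fromBlocks]
      ext i (l | a)
      · have := congrFun (congrFun h2 i) l
        simpa using this.symm
      · simp [coeffMap]
    ext a b
    exact (congrFun (congrFun this (e a)) b).symm
  rw [h3, Matrix.det_mul, Matrix.det_fromBlocks_zero₂₁]
  simp [mul_comm]

/-- The formation of the degeneracy locus commutes with base change. -/
theorem minorIdeal_map {A B : Type*} [CommRing A] [CommRing B] (n k r : ℕ)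
    (x : Fin (n + 1) → A) (y : Fin (n + 1) → B) (φ : A →+* B) (u : B) (hu : IsUnit u)
    (h : ∀ j, φ (x j) = u * y j) (s : Fin r → Coker n k x) :
    (minorIdeal n k r x s).map φ =
      minorIdeal n k r y fun a => cokerMap n k x y φ u h (s a) := by
  apply le_antisymm
  · rw [minorIdeal, Ideal.map_span, Ideal.span_le]
    rintro _ ⟨_, ⟨f, e, hf, rfl⟩, rfl⟩
    rw [det_bordered_map n k r x y φ u h f e]
    refine Ideal.mul_mem_left _ _ (Ideal.subset_span ⟨_, e, fun a => ?_, rfl⟩)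
    simp only [← hf a]
    rfl
  · rw [minorIdeal, Ideal.span_le]
    rintro _ ⟨g, e, hg, rfl⟩
    choose f hf using fun a => Submodule.Quotient.mk_surjective _ (s a)
    have h1 := det_bordered_congr n k r y g (fun a => coeffMap (n + k + 1) φ (f a))
      (fun a => by rw [hg a, ← hf a]; rfl) e
    have h2 := det_bordered_map n k r x y φ u h f e
    rw [h1]
    refine ((Ideal.unit_mul_mem_iff_mem _ (hu.pow (k + 1))).1 ?_)
    rw [← h2]
    exact Ideal.mem_map_of_mem _ (Ideal.subset_span ⟨f, e, hf, rfl⟩)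

end Local

/-! ## Projective space in its standard charts -/

section Projective

/-- The grading of `ℂ[x₀, …, xₙ]` by the degree. -/
abbrev grading (n : ℕ) : ℕ → Submodule ℂ (MvPolynomial (Fin (n + 1)) ℂ) :=
  MvPolynomial.homogeneousSubmodule (Fin (n + 1)) ℂ

instance gradedAlgebraGrading (n : ℕ) : GradedAlgebra (grading n) :=
  MvPolynomial.gradedAlgebra

/-- The coordinate ring of the chart `x_i ≠ 0` of `ℙⁿ = Proj ℂ[x₀, …, xₙ]`. -/
abbrev Chart (n : ℕ) (i : Fin (n + 1)) : Type :=
  HomogeneousLocalization.Away (grading n) (MvPolynomial.X i)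

/-- The coordinate ring of the intersection `x_i x_j ≠ 0` of two charts of `ℙⁿ`. -/
abbrev Overlap (n : ℕ) (i j : Fin (n + 1)) : Type :=
  HomogeneousLocalization.Away (grading n) (MvPolynomial.X i * MvPolynomial.X j)

/-- The constant functions. -/
instance algebraAway (n : ℕ) (f : MvPolynomial (Fin (n + 1)) ℂ) :
    Algebra ℂ (HomogeneousLocalization.Away (grading n) f) where
  toSMul := HomogeneousLocalization.instSMul _
  algebraMap := (HomogeneousLocalization.fromZeroRingHom (grading n) (Submonoid.powers f)).comp
    (algebraMap ℂ (grading n 0))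
  commutes' _ _ := mul_comm _ _
  smul_def' c z := by
    apply HomogeneousLocalization.val_injective
    rw [HomogeneousLocalization.val_smul, HomogeneousLocalization.val_mul, Algebra.smul_def]
    congr 1

instance isScalarTowerAway (n : ℕ) (f : MvPolynomial (Fin (n + 1)) ℂ) :
    IsScalarTower ℂ (HomogeneousLocalization.Away (grading n) f)
      (HomogeneousLocalization.Away (grading n) f) :=
  @IsScalarTower.right ℂ _ _ _ (algebraAway n f)

theorem X_mem (n : ℕ) (i : Fin (n + 1)) :
    (MvPolynomial.X i : MvPolynomial (Fin (n + 1)) ℂ) ∈ grading n 1 :=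
  MvPolynomial.isHomogeneous_X ℂ i

/-- Restriction of functions from the chart `x_i ≠ 0` to `x_i x_j ≠ 0`. -/
def resL (n : ℕ) (i j : Fin (n + 1)) : Chart n i →+* Overlap n i j :=
  HomogeneousLocalization.awayMap (grading n) (X_mem n j) rfl

/-- Restriction of functions from the chart `x_j ≠ 0` to `x_i x_j ≠ 0`. -/
def resR (n : ℕ) (i j : Fin (n + 1)) : Chart n j →+* Overlap n i j :=
  HomogeneousLocalization.awayMap (grading n) (X_mem n i) (mul_comm _ _)

/-- The function `F / x_i ^ d` on the chart `x_i ≠ 0`, for a form `F` of degree `d`. -/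
def dehom {n d : ℕ} (F : MvPolynomial (Fin (n + 1)) ℂ) (hF : F.IsHomogeneous d)
    (i : Fin (n + 1)) : Chart n i :=
  HomogeneousLocalization.Away.mk (grading n) (X_mem n i) d F
    (by simpa using hF)

/-- The affine coordinate `x_m / x_i` on the chart `x_i ≠ 0`. -/
def ratio (n : ℕ) (i m : Fin (n + 1)) : Chart n i :=
  dehom (MvPolynomial.X m) (MvPolynomial.isHomogeneous_X ℂ m) i

theorem resR_dehom {n d : ℕ} (F : MvPolynomial (Fin (n + 1)) ℂ) (hF : F.IsHomogeneous d)
    (i j : Fin (n + 1)) :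
    resR n i j (dehom F hF j) = resR n i j (ratio n j i) ^ d * resL n i j (dehom F hF i) := by
  apply HomogeneousLocalization.val_injective
  simp only [resL, resR, ratio, dehom, HomogeneousLocalization.awayMap_mk,
    HomogeneousLocalization.val_mul, HomogeneousLocalization.val_pow,
    HomogeneousLocalization.Away.val_mk, Localization.mk_pow, Localization.mk_mul]
  rw [Localization.mk_eq_mk_iff, Localization.r_iff_exists]
  exact ⟨1, by simp; ring⟩

theorem resR_ratio (n : ℕ) (i j m : Fin (n + 1)) :
    resR n i j (ratio n j m) = resR n i j (ratio n j i) * resL n i j (ratio n i m) := by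
  simpa [ratio] using resR_dehom (MvPolynomial.X m) (MvPolynomial.isHomogeneous_X ℂ m) i j

theorem isUnit_resR_ratio (n : ℕ) (i j : Fin (n + 1)) :
    IsUnit (resR n i j (ratio n j i)) := by
  have h := resR_ratio n i j j
  have h1 : ratio n j j = 1 := by
    apply HomogeneousLocalization.val_injective
    simp only [ratio, dehom, HomogeneousLocalization.Away.val_mk,
      HomogeneousLocalization.val_one]
    exact (Localization.mk_eq_mk_iff.2 (by
      rw [Localization.r_iff_exists]; exact ⟨1, by simp⟩)).trans Localization.mk_one
  rw [h1, map_one] at h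
  exact IsUnit.of_mul_eq_one _ h.symm

theorem resL_algebraMap (n : ℕ) (i j : Fin (n + 1)) (c : ℂ) :
    resL n i j (algebraMap ℂ _ c) = algebraMap ℂ _ c :=
  HomogeneousLocalization.awayMap_fromZeroRingHom (grading n) (X_mem n j) rfl _

theorem resR_algebraMap (n : ℕ) (i j : Fin (n + 1)) (c : ℂ) :
    resR n i j (algebraMap ℂ _ c) = algebraMap ℂ _ c :=
  HomogeneousLocalization.awayMap_fromZeroRingHom (grading n) (X_mem n i) (mul_comm _ _) _

/-- A closed subscheme of `ℙⁿ`, given by its ideals in the standard charts, which agree on the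
intersections of the charts. -/
@[ext]
structure ClosedSubscheme (n : ℕ) where
  ideal : ∀ i : Fin (n + 1), Ideal (Chart n i)
  glue : ∀ i j : Fin (n + 1), (ideal i).map (resL n i j) = (ideal j).map (resR n i j)

/-- `Z` contains `X` as a closed subscheme: the ideal sheaf of `Z` lies in that of `X`. -/
def ClosedSubscheme.Contains {n : ℕ} (Z X : ClosedSubscheme n) : Prop :=
  ∀ i, Z.ideal i ≤ X.ideal i

/-- The codimension in `ℙⁿ`, the infimum of the heights of the ideals in the charts (a chart which
does not meet the subscheme contributes `⊤`). -/
def ClosedSubscheme.codim {n : ℕ} (X : ClosedSubscheme n) : ℕ∞ :=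
  ⨅ i, (X.ideal i).height

/-- The closed subscheme of `ℙⁿ` with equation `F = 0`, for a form `F` of degree `d`. -/
def hypersurface {n d : ℕ} (F : MvPolynomial (Fin (n + 1)) ℂ) (hF : F.IsHomogeneous d) :
    ClosedSubscheme n where
  ideal i := Ideal.span {dehom F hF i}
  glue i j := by
    rw [Ideal.map_span, Ideal.map_span, Set.image_singleton, Set.image_singleton, resR_dehom,
      Ideal.span_singleton_mul_left_unit ((isUnit_resR_ratio n i j).pow d)]

end Projective

/-! ## The Schwarzenberger bundle and Poncelet varieties -/

section Bundle

/-- The sections over the chart `x_i ≠ 0` of the Schwarzenberger bundle `E_{n,n+k}` on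
`ℙⁿ = ℙ(S_n^∨)`, the cokernel of the multiplication `S_k ⊗ 𝒪(-1) → S_{n+k} ⊗ 𝒪`. Over this chart
`𝒪(-1) ⊆ S_n ⊗ 𝒪` is free, with generator the form with coefficients `x_m / x_i`. -/
abbrev ChartSections (n k : ℕ) (i : Fin (n + 1)) : Type :=
  Coker n k (ratio n i)

/-- The sections of `E_{n,n+k}` over `x_i x_j ≠ 0`. -/
abbrev OverlapSections (n k : ℕ) (i j : Fin (n + 1)) : Type :=
  Coker n k fun m => resL n i j (ratio n i m)

/-- Restriction of sections of `E_{n,n+k}` from the chart `x_i ≠ 0` to `x_i x_j ≠ 0`. -/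
def secResL (n k : ℕ) (i j : Fin (n + 1)) :
    ChartSections n k i →ₛₗ[resL n i j] OverlapSections n k i j :=
  cokerMap n k _ _ (resL n i j) 1 fun _ => (one_mul _).symm

/-- Restriction of sections of `E_{n,n+k}` from the chart `x_j ≠ 0` to `x_i x_j ≠ 0`; the
generators of `𝒪(-1)` on the two charts differ by the unit `x_i / x_j`. -/
def secResR (n k : ℕ) (i j : Fin (n + 1)) :
    ChartSections n k j →ₛₗ[resR n i j] OverlapSections n k i j :=
  cokerMap n k _ _ (resR n i j) (resR n i j (ratio n j i)) fun m => resR_ratio n i j m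

/-- The complex vector space `H⁰(ℙⁿ, E_{n,n+k})`: families of sections over the charts that agree
on the intersections. -/
def globalSections (n k : ℕ) : Submodule ℂ (∀ i : Fin (n + 1), ChartSections n k i) where
  carrier := {s | ∀ i j, secResL n k i j (s i) = secResR n k i j (s j)}
  add_mem' {s t} hs ht i j := by
    simp only [Pi.add_apply, map_add, hs i j, ht i j]
  zero_mem' i j := by simp only [Pi.zero_apply, map_zero]
  smul_mem' c s hs i j := by
    have h1 : ∀ i, (c • s) i = (algebraMap ℂ (Chart n i) c) • s i := fun i => by
      rw [Pi.smul_apply, algebraMap_smul]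
    rw [h1, h1, LinearMap.map_smulₛₗ, LinearMap.map_smulₛₗ, resL_algebraMap, resR_algebraMap,
      hs i j]

/-- The closed subscheme `s₁ ∧ ⋯ ∧ s_r = 0` of `ℙⁿ` defined by `r` global sections of `E_{n,n+k}`.
It is a Poncelet variety when the sections are linearly independent and `r ≤ n`. -/
def degeneracyScheme (n k r : ℕ) (s : Fin r → globalSections n k) : ClosedSubscheme n where
  ideal i := minorIdeal n k r (ratio n i) fun a => (s a : ∀ i, ChartSections n k i) i
  glue i j := by
    rw [minorIdeal_map n k r _ _ (resL n i j) 1 isUnit_one (fun _ => (one_mul _).symm),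
      minorIdeal_map n k r _ _ (resR n i j) _ (isUnit_resR_ratio n i j)
        (fun m => resR_ratio n i j m)]
    congr 1
    ext a
    exact (s a).2 i j

/-- `Z` is the Poncelet variety in `ℙⁿ` defined by some `r` linearly independent sections of
`E_{n,n+k}`. -/
def IsPonceletVariety (n k r : ℕ) (Z : ClosedSubscheme n) : Prop :=
  r ≤ n ∧ ∃ s : Fin r → globalSections n k, LinearIndependent ℂ s ∧ Z = degeneracyScheme n k r s

end Bundle

end Schwarzenberger

end

/-! The global sections of `E_{n,n+k}` are exactly the binary forms of degree `n + k`
(`constSection_surjective`). Near a point `x`, sections given by forms `v₁, …, v_r` are dependent at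
`x` when the multiplication matrix of `x` bordered by the constant columns `v_a` loses rank, that
is, when `x` divides a nonzero form in the span of the `v_a`.

From the hypersurface to the variety: drop one of the `n` sections. Expanding the determinant along
the dropped column puts it in the ideal of maximal minors of the remaining matrix
(`degeneracyScheme_succ_le`). It remains to see that `n - 1` independent sections always degenerate
in codimension exactly 2. A form in the span of the `v_a` depends, up to scalars, on `n - 2`
parameters, and its divisors are algebraic over them; so the degeneracy locus has dimension at most
`n - 2`, and the minors have no common prime factor (`exists_isAlgebraic_div`, `two_le_codim`).
Conversely the span contains a form vanishing at `n - 2` generic points, and a divisor of degree `n`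
through these points is a point of the locus of transcendence degree at least `n - 2`
(`exists_form_vanishing`, `codim_le_two`).

From the variety to the hypersurface: on each chart the equation `F` is a combination of the minors
of the `n - 1` sections, so `x_i^N F` is the determinant with an additional column `A_i` of forms.
Since the minors have no common factor, Hilbert–Burch (`mem_range_of_colDet_eq_zero`) says that
`x_j^N A_i - x_i^N A_j` is a combination of the columns already present. As `x₀^N, x₁^N, x₂^N` is a
regular sequence, these columns glue to one column `B` with determinant `F`
(`exists_eq_smul_add_of_cocycle`). The minors have degree `k + 1`, the degree of `F`, so `B` may be
replaced by its constant part, which is the missing section (`exists_eq_minorForm`). Independence of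
the `n` sections follows from `F ≠ 0`. The same gluing computes the global sections. -/

noncomputable section

namespace Schwarzenberger

/-! ### Maximal minors as a linear form in an additional column; Hilbert–Burch. -/

section ColDet

variable {R m ι : Type*} [CommRing R] [Fintype ι]

/-- The matrix `N` with the additional column `w`. -/
def withCol (N : Matrix m ι R) (w : m → R) : Matrix m (Option ι) R :=
  Matrix.of fun i b => b.elim (w i) (N i)

theorem withCol_mulVec (N : Matrix m ι R) (w : m → R) (c : Option ι → R) (i : m) :
    (withCol N w).mulVec c i = c none * w i + N.mulVec (fun l => c (some l)) i := by
  simp [withCol, Matrix.mulVec, dotProduct, Fintype.sum_option, mul_comm]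

theorem submatrix_withCol_mulVec (N : Matrix m ι R) (σ : Option ι ≃ m) (w : m → R)
    (c : Option ι → R) (a : Option ι) :
    ((withCol N w).submatrix σ id).mulVec c a =
      c none * w (σ a) + N.mulVec (fun l => c (some l)) (σ a) :=
  withCol_mulVec N w c (σ a)

variable [DecidableEq ι]

/-- The determinant of `N` with an additional column, as a linear function of that column. -/
def colDet (N : Matrix m ι R) (σ : Option ι ≃ m) : (m → R) →ₗ[R] R :=
  LinearMap.proj none ∘ₗ Matrix.cramer ((withCol N 0).submatrix σ id) ∘ₗ LinearMap.funLeft R R σ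

theorem colDet_apply (N : Matrix m ι R) (σ : Option ι ≃ m) (w : m → R) :
    colDet N σ w = ((withCol N w).submatrix σ id).det := by
  simp only [colDet, LinearMap.comp_apply, LinearMap.proj_apply, Matrix.cramer_apply]
  congr 1
  ext a (_ | b)
  · simp [withCol, LinearMap.funLeft]
  · simp [withCol]

theorem map_colDet {R' : Type*} [CommRing R'] (φ : R →+* R') (N : Matrix m ι R)
    (σ : Option ι ≃ m) (w : m → R) :
    φ (colDet N σ w) = colDet (N.map φ) σ (φ ∘ w) := by
  rw [colDet_apply, colDet_apply, RingHom.map_det]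
  congr 1
  ext a (_ | b) <;> simp [withCol]

/-- A nonzero vector in the kernel of `N` kills all the maximal minors. -/
theorem colDet_eq_zero_of_mulVec_eq_zero [IsDomain R] (N : Matrix m ι R) (σ : Option ι ≃ m)
    {c : ι → R} (hc : c ≠ 0) (h : N.mulVec c = 0) (w : m → R) : colDet N σ w = 0 := by
  rw [colDet_apply, ← Matrix.exists_mulVec_eq_zero_iff]
  refine ⟨fun b => b.elim 0 c, fun h0 => hc ?_, ?_⟩
  · ext l
    exact congrFun h0 (some l)
  · ext a
    rw [submatrix_withCol_mulVec]
    simpa using congrFun h (σ a)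

/-- A singular square matrix over a domain has a kernel vector; `γ` is its entry at the additional
column. It may vanish, and the users exclude that case separately. -/
theorem exists_of_colDet_eq_zero [IsDomain R] (N : Matrix m ι R) (σ : Option ι ≃ m)
    {w : m → R} (h : colDet N σ w = 0) :
    ∃ (γ : R) (c : ι → R), (γ ≠ 0 ∨ c ≠ 0) ∧ γ • w + N.mulVec c = 0 := by
  rw [colDet_apply, ← Matrix.exists_mulVec_eq_zero_iff] at h
  obtain ⟨c, hc, h⟩ := h
  refine ⟨c none, fun l => c (some l), ?_, ?_⟩
  · by_contra! h0
    refine hc (funext fun b => ?_)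
    cases b with
    | none => exact h0.1
    | some l => exact congrFun h0.2 l
  · ext i
    have := congrFun h (σ.symm i)
    rw [submatrix_withCol_mulVec] at this
    simpa using this

/-- Over a field, a matrix whose maximal minors vanish has a kernel. -/
theorem exists_mulVec_eq_zero_of_colDet {K : Type*} [Field K] (N : Matrix m ι K)
    (σ : Option ι ≃ m) (h : ∀ w, colDet N σ w = 0) : ∃ c ≠ 0, N.mulVec c = 0 := by
  have : Fintype m := Fintype.ofEquiv _ σ
  have hlt : LinearMap.range N.mulVecLin < ⊤ := by
    rw [lt_top_iff_ne_top]
    intro htop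
    have h1 := LinearMap.finrank_range_le N.mulVecLin
    rw [htop, finrank_top, Module.finrank_fintype_fun_eq_card, Module.finrank_fintype_fun_eq_card,
      ← Fintype.card_congr σ, Fintype.card_option] at h1
    omega
  -- For `w` outside the column space, a relation involving `w` with `γ ≠ 0` could be solved for
  -- `w`; so `γ = 0` and the relation lies among the columns of `N`.
  obtain ⟨w, -, hw⟩ := SetLike.exists_of_lt hlt
  obtain ⟨γ, c, hne, h1⟩ := exists_of_colDet_eq_zero N σ (h w)
  have hγ : γ = 0 := by
    by_contra hγ
    refine hw ⟨-(γ⁻¹ • c), ?_⟩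
    rw [Matrix.mulVecLin_apply, Matrix.mulVec_neg, Matrix.mulVec_smul,
      eq_neg_of_add_eq_zero_right h1, smul_neg, neg_neg, smul_smul, inv_mul_cancel₀ hγ, one_smul]
  subst hγ
  exact ⟨c, by simpa using hne, by simpa using h1⟩

/-- Remove the primes of `γ` one at a time: each `p` misses some `d a`, hence divides `c`, and can
be cancelled from both sides. -/
theorem dvd_of_forall_dvd_mul {α A : Type*} [CommRing A] [IsDomain A]
    [UniqueFactorizationMonoid A] {d : α → A} (hd : ∀ p, Prime p → ∃ a, ¬ p ∣ d a) {γ : A}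
    (hγ : γ ≠ 0) : ∀ {c : A}, (∀ a, γ ∣ d a * c) → γ ∣ c := by
  induction γ using UniqueFactorizationMonoid.induction_on_prime with
  | h₁ => exact absurd rfl hγ
  | h₂ x hx => exact fun _ => hx.dvd
  | h₃ γ p h0 hp ih =>
    intro c hc
    obtain ⟨a, ha⟩ := hd p hp
    obtain ⟨c, rfl⟩ := (hp.dvd_or_dvd ((dvd_mul_right p γ).trans (hc a))).resolve_left ha
    refine mul_dvd_mul_left p (ih h0 fun b => ?_)
    have := hc b
    rw [mul_left_comm] at this
    exact (mul_dvd_mul_iff_left hp.ne_zero).1 this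

/-- The Hilbert–Burch theorem: if the maximal minors of `N` have no common prime factor, then their
syzygies are the combinations of the columns of `N`. -/
theorem mem_range_of_colDet_eq_zero [IsDomain R] [UniqueFactorizationMonoid R]
    (N : Matrix m ι R) (σ : Option ι ≃ m) (hN : ∀ p, Prime p → ∃ w, ¬ p ∣ colDet N σ w)
    (h0 : ∃ w, colDet N σ w ≠ 0) {w : m → R} (hw : colDet N σ w = 0) :
    w ∈ LinearMap.range N.mulVecLin := by
  obtain ⟨γ, c, hne, h1⟩ := exists_of_colDet_eq_zero N σ hw
  have hγ : γ ≠ 0 := by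
    rintro rfl
    obtain ⟨u, hu⟩ := h0
    exact hu (colDet_eq_zero_of_mulVec_eq_zero N σ (by simpa using hne) (by simpa using h1) u)
  have h2 : ∀ l, γ ∣ c l := fun l => by
    refine dvd_of_forall_dvd_mul hN hγ fun u => ?_
    let A := (withCol N u).submatrix σ id
    have h3 : A.mulVec (fun b => b.elim 0 c) = -(γ • (w ∘ σ)) := by
      ext a
      rw [submatrix_withCol_mulVec]
      have := congrFun h1 (σ a)
      simp only [Pi.add_apply, Pi.smul_apply, smul_eq_mul, Pi.zero_apply] at this
      simp only [Option.elim_none, Option.elim_some, zero_mul, zero_add, Pi.neg_apply,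
        Pi.smul_apply, Function.comp_apply, smul_eq_mul]
      linear_combination this
    -- Cramer's rule: applying the adjugate gives `det A * c l` as a multiple of `γ`, for every
    -- additional column `u`.
    have h4 := congrFun (congrArg A.adjugate.mulVec h3) (some l)
    rw [Matrix.mulVec_mulVec, Matrix.adjugate_mul, Matrix.mulVec_neg, Matrix.mulVec_smul,
      Matrix.smul_mulVec, Matrix.one_mulVec] at h4
    simp only [Pi.smul_apply, Option.elim_some, smul_eq_mul, Pi.neg_apply] at h4
    rw [colDet_apply, h4]
    exact (dvd_mul_right _ _).neg_right
  choose d hd using h2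
  refine ⟨-d, ?_⟩
  ext i
  have h3 := congrFun h1 i
  have h4 : c = γ • d := funext hd
  rw [h4, Matrix.mulVec_smul] at h3
  simp only [Pi.add_apply, Pi.smul_apply, smul_eq_mul, Pi.zero_apply, ← mul_add] at h3
  rw [Matrix.mulVecLin_apply, Matrix.mulVec_neg, Pi.neg_apply]
  linear_combination -((mul_eq_zero.1 h3).resolve_left hγ)

/-- Expansion along the additional column. -/
theorem det_withCol_mem_span (N : Matrix m ι R) (w : m → R) (e : Option ι → m) :
    ((withCol N w).submatrix e id).det ∈
      Ideal.span {d : R | ∃ e : ι → m, d = (N.submatrix e id).det} := by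
  let α := Fintype.equivFin ι
  -- The additional column is numbered 0, to allow the Laplace expansion along column zero.
  let E : Fin (Fintype.card ι + 1) ≃ Option ι :=
    (finSuccEquiv (Fintype.card ι)).trans (Equiv.optionCongr α.symm)
  have hE : ∀ i, E (Fin.succ i) = some (α.symm i) := fun i => by simp [E]; rfl
  rw [← Matrix.det_submatrix_equiv_self E, Matrix.det_succ_column_zero]
  refine Ideal.sum_mem _ fun i _ => Ideal.mul_mem_left _ _ (Ideal.subset_span
    ⟨fun l => e (E (i.succAbove (α l))), ?_⟩)
  rw [← Matrix.det_submatrix_equiv_self α]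
  congr 1
  ext a b
  simp [withCol, hE]

/-- The maximal minors of `N` generate the image of `colDet`. -/
theorem span_minors_eq_range (N : Matrix m ι R) (σ : Option ι ≃ m) :
    Ideal.span {d : R | ∃ e : ι → m, d = (N.submatrix e id).det} =
      LinearMap.range (colDet N σ) := by
  classical
  have : Fintype m := Fintype.ofEquiv _ σ
  refine le_antisymm (Ideal.span_le.2 ?_) ?_
  · rintro _ ⟨e, rfl⟩
    by_cases he : Function.Injective e
    · obtain ⟨j, hj⟩ : ∃ j, j ∉ Set.range e := by
        by_contra! h
        have h1 := Fintype.card_le_of_surjective e h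
        rw [← Fintype.card_congr σ, Fintype.card_option] at h1
        omega
      let g : Option ι → m := fun b => b.elim j e
      have hg : Function.Injective g := by
        rintro (_ | a) (_ | b) hab
        · rfl
        · exact (hj ⟨b, hab.symm⟩).elim
        · exact (hj ⟨a, hab⟩).elim
        · exact congrArg some (he hab)
      let τ : Option ι ≃ Option ι := Equiv.ofBijective (σ.symm ∘ g)
        (Finite.injective_iff_bijective.1 (σ.symm.injective.comp hg))
      have h1 : ((withCol N (Pi.single j 1)).submatrix g id).det =
          Equiv.Perm.sign τ * colDet N σ (Pi.single j 1) := by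
        rw [colDet_apply, ← Matrix.det_permute τ]
        congr 1
        ext a b
        simp [τ]
      have h2 : ((withCol N (Pi.single j 1)).submatrix g id).det = (N.submatrix e id).det := by
        let s : ι ⊕ Unit ≃ Option ι := (Equiv.optionEquivSumPUnit ι).symm
        rw [← Matrix.det_submatrix_equiv_self s]
        have h3 : ((withCol N (Pi.single j 1)).submatrix g id).submatrix s s =
            Matrix.fromBlocks (N.submatrix e id) 0 (Matrix.of fun _ l => N j l) 1 := by
          ext (a | a) (b | b)
          · simp [s, g, withCol]
          · have : e a ≠ j := fun h => hj ⟨a, h⟩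
            simp [s, g, withCol, this]
          · simp [s, g, withCol]
          · simp [s, g, withCol]
        rw [h3, Matrix.det_fromBlocks_zero₁₂, Matrix.det_one, mul_one]
      rw [← h2, h1]
      refine ⟨(Equiv.Perm.sign τ : R) • Pi.single j 1, by simp⟩
    · simp only [Function.Injective, not_forall] at he
      obtain ⟨a, b, hab, hne⟩ := he
      have : (N.submatrix e id).det = 0 :=
        Matrix.det_zero_of_row_eq hne (by ext l; simp [hab])
      rw [this]
      exact Submodule.zero_mem _
  · rintro _ ⟨w, rfl⟩
    rw [colDet_apply]
    exact det_withCol_mem_span N w σ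

end ColDet

/-! ### Torsion of cokernels and gluing along a regular sequence. -/

section Descent

variable {R m ι : Type*} [CommRing R] [Fintype ι]

/-- If `N` stays injective modulo `t`, its cokernel has no `t`-torsion. -/
theorem mem_range_of_pow_smul_mem [IsDomain R] {N : Matrix m ι R} {t : R} (ht : t ≠ 0)
    (hN : ∀ c : ι → R, (∀ i, t ∣ N.mulVec c i) → ∀ l, t ∣ c l) (q : ℕ) {g : m → R}
    (hg : t ^ q • g ∈ LinearMap.range N.mulVecLin) : g ∈ LinearMap.range N.mulVecLin := by
  induction q with
  | zero => simpa using hg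
  | succ q ih =>
    obtain ⟨c, hc⟩ := hg
    have h1 : ∀ l, t ∣ c l := hN c fun i => by
      rw [← Matrix.mulVecLin_apply, hc, pow_succ', mul_smul]
      exact dvd_mul_right _ _
    choose d hd using h1
    have h2 : c = t • d := funext hd
    rw [h2, map_smul, pow_succ', mul_smul] at hc
    exact ih ⟨d, smul_right_injective _ ht hc⟩

/-- Gluing along three elements `u₀, u₁, u₂` that behave like a regular sequence. -/
theorem exists_eq_smul_add_of_cocycle {N : Matrix m ι R}
    (hN : ∀ c : ι → R, N.mulVec c = 0 → c = 0) {u₀ u₁ u₂ : R}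
    (h01 : ∀ b : R, u₀ ∣ u₁ * b → u₀ ∣ b)
    (h012 : ∀ b : R, u₂ * b ∈ Ideal.span {u₀, u₁} → b ∈ Ideal.span {u₀, u₁}) {A₀ A₁ A₂ : m → R}
    (H01 : u₁ • A₀ - u₀ • A₁ ∈ LinearMap.range N.mulVecLin)
    (H02 : u₂ • A₀ - u₀ • A₂ ∈ LinearMap.range N.mulVecLin)
    (H12 : u₂ • A₁ - u₁ • A₂ ∈ LinearMap.range N.mulVecLin) :
    ∃ (A : m → R) (c : ι → R), A₀ = u₀ • A + N.mulVec c := by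
  obtain ⟨b₁, hb₁⟩ := H01
  obtain ⟨b₂, hb₂⟩ := H02
  obtain ⟨b₀, hb₀⟩ := H12
  -- The Koszul combination of the three differences vanishes identically, so injectivity of `N`
  -- transfers it to the coefficient vectors.
  have h1 : u₂ • b₁ - u₁ • b₂ + u₀ • b₀ = 0 := by
    refine hN _ ?_
    rw [← Matrix.mulVecLin_apply, map_add, map_sub, map_smul, map_smul, map_smul, hb₁, hb₂, hb₀]
    module
  have h2 : ∀ l, b₁ l ∈ Ideal.span {u₀, u₁} := fun l => h012 _ <| by
    rw [Ideal.mem_span_pair]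
    have := congrFun h1 l
    simp only [Pi.add_apply, Pi.sub_apply, Pi.smul_apply, smul_eq_mul, Pi.zero_apply] at this
    exact ⟨-b₀ l, b₂ l, by linear_combination -this⟩
  simp only [Ideal.mem_span_pair] at h2
  choose d e hde using h2
  have h3 : b₁ = u₀ • d + u₁ • e := by
    ext l
    simp [← hde l, mul_comm]
  rw [h3, map_add, map_smul, map_smul] at hb₁
  -- Substituting `b₁ = u₀ d + u₁ e` gives `u₁ (A₀ - N e) = u₀ (N d + A₁)`, and `u₁` is regular
  -- modulo `u₀`.
  have h4 : ∀ i, u₀ ∣ (A₀ - N.mulVecLin e) i := fun i => h01 _ <| by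
    have := congrFun hb₁ i
    simp only [Pi.add_apply, Pi.sub_apply, Pi.smul_apply, smul_eq_mul] at this
    exact ⟨N.mulVecLin d i + A₁ i, by simp only [Pi.sub_apply]; linear_combination -this⟩
  choose A hA using h4
  refine ⟨A, e, ?_⟩
  ext i
  have := hA i
  simp only [Pi.sub_apply, Matrix.mulVecLin_apply] at this
  simp only [Pi.add_apply, Pi.smul_apply, smul_eq_mul]
  linear_combination this

end Descent

/-! ### Transcendence degree, heights of primes and hypersurfaces. -/

section Transcendence

open IntermediateField.algebraAdjoinAdjoin

theorem mem_matroid_closure {F L : Type*} [Field F] [Field L] [Algebra F L] {s : Set L} {a : L}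
    (h : IsAlgebraic (IntermediateField.adjoin F s) a) :
    a ∈ (AlgebraicIndependent.matroid F L).closure s := by
  rw [AlgebraicIndependent.matroid_closure_eq, SetLike.mem_coe, Subalgebra.mem_algebraicClosure]
  exact (IsFractionRing.isAlgebraic_iff (Algebra.adjoin F s) (IntermediateField.adjoin F s) L).2 h

theorem card_le_eRk {F L ι : Type*} [Field F] [Field L] [Algebra F L] [Fintype ι] {y : ι → L}
    (hy : AlgebraicIndependent F y) {s : Set L}
    (h : ∀ i, IsAlgebraic (IntermediateField.adjoin F s) (y i)) :
    (Fintype.card ι : ℕ∞) ≤ (AlgebraicIndependent.matroid F L).eRk s := by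
  rw [← Matroid.eRk_closure_eq]
  have h1 : (AlgebraicIndependent.matroid F L).Indep (Set.range y) := by
    rw [AlgebraicIndependent.matroid_indep_iff]
    exact hy.to_subtype_range
  have h2 : (Set.range y).encard = Fintype.card ι := by
    rw [← Set.image_univ, hy.injective.encard_image, Set.encard_univ, ENat.card_eq_coe_fintype_card]
  rw [← h2]
  refine h1.encard_le_eRk_of_subset ?_
  rintro _ ⟨i, rfl⟩
  exact mem_matroid_closure (h i)

/-- Elements which are algebraic over the field generated by `s` contain at most `s.encard`
algebraically independent ones. -/
theorem card_le_encard {F L ι : Type*} [Field F] [Field L] [Algebra F L] [Fintype ι] {y : ι → L}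
    (hy : AlgebraicIndependent F y) {s : Set L}
    (h : ∀ i, IsAlgebraic (IntermediateField.adjoin F s) (y i)) :
    (Fintype.card ι : ℕ∞) ≤ s.encard :=
  (card_le_eRk hy h).trans (Matroid.eRk_le_encard _ _)

/-- A basis of the matroid on the range of `x` has at least as many elements as `ι`; any subset of
it of the right size is independent. -/
theorem exists_algebraicIndependent_comp {F L ι κ : Type*} [Field F] [Field L] [Algebra F L]
    [Fintype ι] {y : ι → L} (hy : AlgebraicIndependent F y) {x : κ → L}
    (h : ∀ i, IsAlgebraic (IntermediateField.adjoin F (Set.range x)) (y i)) :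
    ∃ t : Fin (Fintype.card ι) → κ, AlgebraicIndependent F (x ∘ t) := by
  obtain ⟨I, hI⟩ := (AlgebraicIndependent.matroid F L).exists_isBasis (Set.range x)
  have h1 := card_le_eRk hy h
  rw [hI.eRk_eq_encard] at h1
  obtain ⟨J, hJI, hJ⟩ := Set.exists_subset_encard_eq h1
  have hfin : J.Finite := Set.finite_of_encard_eq_coe hJ
  have : Fintype J := hfin.fintype
  have hcard : Fintype.card J = Fintype.card ι := by
    rw [← Set.toFinset_card]
    have := hJ
    rw [Set.encard_eq_coe_toFinset_card] at this
    exact_mod_cast this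
  let ε : Fin (Fintype.card ι) ≃ J := (Fintype.equivFinOfCardEq hcard).symm
  have h2 : ∀ a, ∃ j, x j = ε a := fun a => hI.subset (hJI (ε a).2)
  choose t ht using h2
  refine ⟨t, ?_⟩
  have h3 : AlgebraicIndependent F (fun a : J => (a : L)) :=
    (AlgebraicIndependent.matroid_indep_iff.1 (hI.indep.subset hJI))
  have h4 : x ∘ t = (fun a : J => (a : L)) ∘ ε := funext ht
  rw [h4]
  exact h3.comp _ ε.injective

/-- Passing to a strictly smaller prime raises the transcendence degree of the quotient. -/
theorem exists_algebraicIndependent_of_lt {F R ι : Type*} [Field F] [CommRing R] [Algebra F R]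
    {P Q : Ideal R} [P.IsPrime] (hPQ : P < Q) {y : ι → R}
    (hy : AlgebraicIndependent F fun i => Ideal.Quotient.mk Q (y i)) :
    ∃ z : R, AlgebraicIndependent F fun o : Option ι => Ideal.Quotient.mk P (o.elim z y) := by
  obtain ⟨z, hzQ, hzP⟩ := SetLike.exists_of_lt hPQ
  refine ⟨z, ?_⟩
  let π : (R ⧸ P) →ₐ[F] (R ⧸ Q) := Ideal.Quotient.factorₐ F hPQ.le
  have hπ : ∀ a, π (Ideal.Quotient.mk P a) = Ideal.Quotient.mk Q a := fun a => rfl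
  let y' : ι → R ⧸ P := fun i => Ideal.Quotient.mk P (y i)
  have h1 : (fun o : Option ι => Ideal.Quotient.mk P (o.elim z y)) =
      fun o : Option ι => o.elim (Ideal.Quotient.mk P z) y' := by
    ext (_ | _) <;> rfl
  have h2 : AlgebraicIndependent F (π ∘ y') := hy
  rw [h1, AlgebraicIndependent.option_iff]
  refine ⟨h2.of_comp, fun halg => ?_⟩
  -- If `z` were algebraic over the algebra generated by `y'`, the kernel of `π`, which contains the
  -- nonzero class of `z`, would meet that algebra nontrivially. This contradicts the independence
  -- of the images of `y'` under `π`.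
  have h3 := Ideal.comap_ne_bot_of_algebraic_mem (I := RingHom.ker π)
    (x := Ideal.Quotient.mk P z) (fun h => hzP (Ideal.Quotient.eq_zero_iff_mem.1 h))
    (by rw [RingHom.mem_ker, hπ]; exact Ideal.Quotient.eq_zero_iff_mem.2 hzQ) halg
  obtain ⟨b, hb, hb0⟩ := Submodule.exists_mem_ne_zero_of_ne_bot h3
  obtain ⟨q, hq⟩ := (Algebra.adjoin_range_eq_range_aeval F y' ▸ b.2 :
    (b : R ⧸ P) ∈ (MvPolynomial.aeval y' : MvPolynomial ι F →ₐ[F] R ⧸ P).range)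
  have h4 : π (b : R ⧸ P) = 0 := hb
  rw [← hq] at h4
  have h5 : MvPolynomial.aeval (π ∘ y') q = 0 := by
    rw [← h4]
    exact (MvPolynomial.comp_aeval_apply y' π q).symm
  have h6 : q = 0 := h2.eq_zero_of_aeval_eq_zero _ h5
  refine hb0 (Subtype.ext ?_)
  rw [← hq, h6]
  simp

/-- One half of the dimension formula: descending a chain of primes below `P`, each strict inclusion
adds one independent element to the quotient. -/
theorem add_le_trdeg {F R : Type} [Field F] [CommRing R] [Algebra F R] (m : ℕ) :
    ∀ (d : ℕ) (P : Ideal R) [P.IsPrime] (y : Fin d → R),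
      (AlgebraicIndependent F fun i => Ideal.Quotient.mk P (y i)) → (m : ℕ∞) ≤ P.height →
        ((d + m : ℕ) : Cardinal) ≤ Algebra.trdeg F R := by
  induction m with
  | zero =>
    intro d P _ y hy _
    have : AlgebraicIndependent F y :=
      AlgebraicIndependent.of_comp (Ideal.Quotient.mkₐ F P) hy
    simpa using this.cardinalMk_le_trdeg
  | succ m ih =>
    intro d P _ y hy hm
    have h1 : ¬ P.height ≤ m := fun h => by
      have := hm.trans h
      norm_cast at this
      omega
    rw [Ideal.height_le_iff] at h1
    push Not at h1
    obtain ⟨Q, hQ, hlt, hQm⟩ := h1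
    obtain ⟨z, hz⟩ := exists_algebraicIndependent_of_lt hlt hy
    have h2 := ih (d + 1) Q (fun a => (finSuccEquiv d a).elim z y)
      (hz.comp _ (finSuccEquiv d).injective) hQm
    rwa [add_right_comm, add_assoc] at h2

/-- The quotient of a polynomial ring by a prime element has all but one of the variables
algebraically independent. -/
theorem exists_algebraicIndependent_of_prime {F A σ : Type*} [Field F] [CommRing A] [Algebra F A]
    (e : A ≃ₐ[F] MvPolynomial σ F) {p : A} (hp : Prime p) :
    ∃ m, AlgebraicIndependent F fun l : {l : σ // l ≠ m} =>
      Ideal.Quotient.mk (Ideal.span {p}) (e.symm (MvPolynomial.X (l : σ))) := by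
  have hp' : Prime (e p) := (MulEquiv.prime_iff e.toMulEquiv).2 hp
  -- A prime is not constant, so it involves some variable `m`. Degrees in `m` add up in products,
  -- so no nonzero multiple of it is free of `m`.
  obtain ⟨m, hm⟩ : ∃ m, MvPolynomial.degreeOf m (e p) ≠ 0 := by
    by_contra! h
    have h1 : (e p).totalDegree = 0 := by
      rw [MvPolynomial.totalDegree_eq_zero_iff]
      intro u hu i
      exact Nat.le_zero.1 ((MvPolynomial.degreeOf_le_iff.1 (h i).le) u hu)
    rw [MvPolynomial.totalDegree_eq_zero_iff_eq_C] at h1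
    rw [h1] at hp'
    by_cases h0 : MvPolynomial.coeff 0 (e p) = 0
    · exact hp'.ne_zero (by rw [h0, map_zero])
    · exact hp'.not_isUnit ((isUnit_iff_ne_zero.2 h0).map MvPolynomial.C)
  refine ⟨m, ?_⟩
  rw [algebraicIndependent_iff]
  intro q hq
  have h1 : ∀ q : MvPolynomial {l : σ // l ≠ m} F,
      MvPolynomial.aeval (fun l : {l : σ // l ≠ m} => Ideal.Quotient.mk (Ideal.span {p})
        (e.symm (MvPolynomial.X (l : σ)))) q =
      Ideal.Quotient.mkₐ F (Ideal.span {p}) (e.symm (MvPolynomial.rename Subtype.val q)) := by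
    intro q
    have : MvPolynomial.aeval (fun l : {l : σ // l ≠ m} => Ideal.Quotient.mk (Ideal.span {p})
        (e.symm (MvPolynomial.X (l : σ)))) =
        ((Ideal.Quotient.mkₐ F (Ideal.span {p})).comp (e.symm : MvPolynomial σ F →ₐ[F] A)).comp
          (MvPolynomial.rename Subtype.val) := by
      ext l
      simp
    rw [this]
    rfl
  rw [h1, Ideal.Quotient.mkₐ_eq_mk, Ideal.Quotient.eq_zero_iff_mem,
    Ideal.mem_span_singleton] at hq
  by_contra hq0
  have h2 : e p ∣ MvPolynomial.rename Subtype.val q := by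
    simpa using map_dvd e hq
  obtain ⟨g, hg⟩ := h2
  have h3 : MvPolynomial.rename (Subtype.val : {l : σ // l ≠ m} → σ) q ≠ 0 := fun h =>
    hq0 (MvPolynomial.rename_injective _ Subtype.val_injective (by rw [h, map_zero]))
  have hg0 : g ≠ 0 := by
    rintro rfl
    exact h3 (by rw [hg, mul_zero])
  have h4 : MvPolynomial.degreeOf m (MvPolynomial.rename (Subtype.val : {l : σ // l ≠ m} → σ) q)
      = 0 := by
    classical
    by_contra h
    rw [← ne_eq, ← MvPolynomial.mem_vars_iff_degreeOf_ne_zero] at h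
    obtain ⟨l, -, hl⟩ := Finset.mem_image.1 (MvPolynomial.vars_rename _ _ h)
    exact l.2 hl
  rw [hg, MvPolynomial.degreeOf_mul_eq hp'.ne_zero hg0] at h4
  omega

end Transcendence

/-! ### Binary forms as polynomials in one variable: divisors and vanishing. -/

section Forms

open Polynomial

/-- Identifies binary forms with polynomials of bounded degree, so that questions on the matrix
become questions on divisibility in `A[X]`. -/
theorem ofFn_multMatrix_mulVec {A : Type*} [CommRing A] [DecidableEq A] (n k : ℕ)
    (x : Fin (n + 1) → A) (g : Fin (k + 1) → A) :
    ofFn (n + k + 1) ((multMatrix n k x).mulVec g) = ofFn (n + 1) x * ofFn (k + 1) g := by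
  rw [ofFn_eq_sum_monomial, ofFn_eq_sum_monomial, ofFn_eq_sum_monomial, Finset.sum_mul_sum]
  simp only [Matrix.mulVec, dotProduct, multMatrix, Matrix.of_apply, Finset.sum_mul, map_sum,
    monomial_mul_monomial]
  have h1 : ∀ (j : Fin (n + 1)) (l : Fin (k + 1)), ∑ i : Fin (n + k + 1),
      monomial (i : ℕ) ((if (j : ℕ) + (l : ℕ) = (i : ℕ) then x j else 0) * g l) =
        monomial ((j : ℕ) + l) (x j * g l) := fun j l => by
    have hlt : (j : ℕ) + l < n + k + 1 := by omega
    rw [Finset.sum_eq_single (⟨j + l, hlt⟩ : Fin (n + k + 1))]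
    · simp
    · intro i _ hi
      rw [if_neg fun h => hi (Fin.ext h.symm), zero_mul, map_zero]
    · simp
  simp only [← h1]
  rw [Finset.sum_comm]
  refine (Finset.sum_congr rfl fun l _ => Finset.sum_comm).trans Finset.sum_comm

theorem ofFn_map {A B : Type*} [CommRing A] [CommRing B] [DecidableEq A] [DecidableEq B]
    (φ : A →+* B) (N : ℕ) (v : Fin N → A) : (ofFn N v).map φ = ofFn N (φ ∘ v) := by
  rw [ofFn_eq_sum_monomial, ofFn_eq_sum_monomial, Polynomial.map_sum]
  simp

theorem ofFn_ne_zero {A : Type*} [CommRing A] [DecidableEq A] {N : ℕ} {v : Fin N → A}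
    (hv : v ≠ 0) : ofFn N v ≠ 0 := fun h =>
  hv (injective_ofFn N (by rw [h, map_zero]))

theorem multMatrix_mulVec_injective {A : Type*} [CommRing A] [IsDomain A] {n k : ℕ}
    {x : Fin (n + 1) → A} (hx : x ≠ 0) {g : Fin (k + 1) → A}
    (h : (multMatrix n k x).mulVec g = 0) : g = 0 := by
  classical
  by_contra hg
  have h1 := ofFn_multMatrix_mulVec n k x g
  rw [h, map_zero] at h1
  exact mul_ne_zero (ofFn_ne_zero hx) (ofFn_ne_zero hg) h1.symm

/-- Multiplication by a form stays injective modulo a prime that does not divide the form. -/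
theorem dvd_of_dvd_multMatrix_mulVec {A : Type*} [CommRing A] {n k : ℕ} {x : Fin (n + 1) → A}
    {t : A} (ht : Prime t) (hx : ∃ j, ¬ t ∣ x j) (g : Fin (k + 1) → A)
    (h : ∀ i, t ∣ (multMatrix n k x).mulVec g i) (l : Fin (k + 1)) : t ∣ g l := by
  have : (Ideal.span {t}).IsPrime := (Ideal.span_singleton_prime ht.ne_zero).2 ht
  let π := Ideal.Quotient.mk (Ideal.span {t})
  have hπ : ∀ a, π a = 0 ↔ t ∣ a := fun a => by
    rw [Ideal.Quotient.eq_zero_iff_mem, Ideal.mem_span_singleton]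
  have h1 : (multMatrix n k (π ∘ x)).mulVec (π ∘ g) = 0 := by
    have h2 := multMatrix_map n k x (π ∘ x) π 1 (by simp)
    rw [one_smul] at h2
    ext i
    rw [← h2, ← RingHom.map_mulVec]
    exact (hπ _).2 (h i)
  obtain ⟨j, hj⟩ := hx
  have h2 := multMatrix_mulVec_injective (x := π ∘ x)
    (fun h => hj ((hπ _).1 (congrFun h j))) h1
  exact (hπ _).1 (congrFun h2 l)

theorem bordered_mulVec {A : Type*} [CommRing A] (n k r : ℕ) (x : Fin (n + 1) → A)
    (f : Fin r → Fin (n + k + 1) → A) (c : Fin (k + 1) ⊕ Fin r → A) :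
    (bordered n k r x f).mulVec c =
      (multMatrix n k x).mulVec (fun l => c (Sum.inl l)) + ∑ a, c (Sum.inr a) • f a := by
  ext i
  simp [bordered, Matrix.mulVec, dotProduct, Fintype.sum_sum_type, mul_comm]

theorem bordered_map {A B : Type*} [CommRing A] [CommRing B] (n k r : ℕ) (x : Fin (n + 1) → A)
    (f : Fin r → Fin (n + k + 1) → A) (φ : A →+* B) :
    (bordered n k r x f).map φ = bordered n k r (φ ∘ x) (fun a => φ ∘ f a) := by
  have h2 := multMatrix_map n k x (φ ∘ x) φ 1 (by simp)
  rw [one_smul] at h2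
  ext i (l | a)
  · simp only [bordered, Matrix.map_apply, Matrix.fromCols_apply_inl]
    exact congrFun (congrFun h2 i) l
  · simp [bordered]

/-- If a form with coefficients `x` has a nonzero multiple in the span of `r` forms with constant
coefficients, then the ratios of its coefficients are algebraic over less than `r` elements. -/
theorem exists_isAlgebraic_div {F L : Type*} [Field F] [Field L] [Algebra F L] {n k r : ℕ}
    {v : Fin r → Fin (n + k + 1) → F} (hv : LinearIndependent F v) {x : Fin (n + 1) → L}
    {i : Fin (n + 1)} (hi : x i ≠ 0) {c : Fin (k + 1) ⊕ Fin r → L} (hc : c ≠ 0)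
    (h : (bordered n k r x fun a => algebraMap F L ∘ v a).mulVec c = 0) :
    ∃ T : Finset L, T.card < r ∧
      ∀ m, IsAlgebraic (IntermediateField.adjoin F (T : Set L)) (x m / x i) := by
  classical
  have hx : x ≠ 0 := fun h0 => hi (congrFun h0 i)
  rw [bordered_mulVec] at h
  set g := fun l => c (Sum.inl l) with hg
  set a := fun j => c (Sum.inr j) with ha
  have ha0 : a ≠ 0 := by
    intro ha0
    have h1 : ∀ j, c (Sum.inr j) = 0 := fun j => congrFun ha0 j
    simp only [h1, zero_smul, Finset.sum_const_zero, add_zero] at h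
    have h2 := multMatrix_mulVec_injective hx h
    refine hc (funext fun b => ?_)
    rcases b with l | j
    · exact congrFun h2 l
    · exact h1 j
  obtain ⟨j₀, hj₀⟩ := Function.ne_iff.1 ha0
  rw [Pi.zero_apply] at hj₀
  -- Normalizing the coefficient at `j₀` to 1 leaves at most `r - 1` parameters.
  let b : Fin r → L := fun j => a j / a j₀
  let T : Finset L := (Finset.univ.erase j₀).image b
  let E := IntermediateField.adjoin F (T : Set L)
  have hb : ∀ j, b j ∈ E := fun j => by
    by_cases hj : j = j₀
    · rw [hj]
      simp only [b, div_self hj₀]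
      exact one_mem E
    · exact IntermediateField.subset_adjoin F _
        (Finset.mem_coe.2 (Finset.mem_image_of_mem b (by simp [hj])))
  refine ⟨T, ?_, ?_⟩
  · refine Finset.card_image_le.trans_lt ?_
    rw [Finset.card_erase_of_mem (Finset.mem_univ _), Finset.card_univ, Fintype.card_fin]
    have := j₀.2
    omega
  let wE : Fin (n + k + 1) → E := fun m => ∑ j, (⟨b j, hb j⟩ : E) * algebraMap F E (v j m)
  have hw : algebraMap E L ∘ wE = ∑ j, b j • (algebraMap F L ∘ v j) := by
    ext m
    simp only [Function.comp_apply, wE, map_sum, map_mul, Finset.sum_apply, Pi.smul_apply,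
      smul_eq_mul]
    rfl
  have hw0 : wE ≠ 0 := by
    intro h0
    have h1 := (linearIndependent_algebraMap_comp_iff (S := L)).2 hv
    rw [Fintype.linearIndependent_iff] at h1
    have h2 := h1 b (by rw [← hw, h0]; ext; simp) j₀
    simp only [b, div_self hj₀] at h2
    exact one_ne_zero h2
  set P := ofFn (n + 1) x with hP
  set W := ofFn (n + k + 1) wE with hW
  have hP0 : P ≠ 0 := ofFn_ne_zero hx
  have hW0 : W ≠ 0 := ofFn_ne_zero hw0
  have hdvd : P ∣ W.map (algebraMap E L) := by
    refine ⟨ofFn (k + 1) ((-(a j₀)⁻¹) • g), ?_⟩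
    rw [hW, ofFn_map, hP, ← ofFn_multMatrix_mulVec, Matrix.mulVec_smul,
      eq_neg_of_add_eq_zero_left h, hw, smul_neg, neg_smul, neg_neg, Finset.smul_sum]
    congr 1
    refine Finset.sum_congr rfl fun j _ => ?_
    rw [smul_smul]
    congr 1
    simp [b, ha, div_eq_inv_mul]
  -- A monic divisor of a monic polynomial over `E` has coefficients integral over `E`. Hence the
  -- form `P`, made monic, has coefficients algebraic over `E`.
  have h1 : P * C (P.leadingCoeff)⁻¹ ∈
      Polynomial.lifts (algebraMap (integralClosure E L) L) := by
    refine integralClosure.mem_lifts_of_monic_of_dvd_map L (monic_mul_leadingCoeff_inv hW0)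
      (monic_mul_leadingCoeff_inv hP0) ?_
    rw [Polynomial.map_mul, Polynomial.map_C]
    have hu : IsUnit (C (P.leadingCoeff)⁻¹ : L[X]) :=
      (isUnit_iff_ne_zero.2 (inv_ne_zero (leadingCoeff_ne_zero.2 hP0))).map C
    exact (hu.mul_right_dvd.2 hdvd).mul_right _
  have h2 : ∀ m, IsAlgebraic E (x m * (P.leadingCoeff)⁻¹) := fun m => by
    rw [lifts_iff_coeff_lifts] at h1
    obtain ⟨y, hy⟩ := h1 m
    rw [coeff_mul_C, hP, ofFn_coeff_eq_val_of_lt x m.2, ← hP] at hy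
    have h3 : x m = x ⟨m, m.2⟩ := rfl
    rw [h3, ← hy]
    exact IsIntegral.isAlgebraic y.2
  intro m
  have h3 : x m / x i = (x m * (P.leadingCoeff)⁻¹) * (x i * (P.leadingCoeff)⁻¹)⁻¹ := by
    have : P.leadingCoeff ≠ 0 := leadingCoeff_ne_zero.2 hP0
    field_simp
  rw [h3]
  exact (h2 m).mul (IsAlgebraic.inv_iff.2 (h2 i))

/-- Up to `a` linear factors are moved into `q`, one root at a time. Degree drops, corresponding to
roots at infinity, are covered by the inequalities. -/
theorem exists_eq_mul_of_natDegree_le {K : Type*} [Field K] [IsAlgClosed K] (b : ℕ) :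
    ∀ (a : ℕ) {u : K[X]}, u ≠ 0 → u.natDegree ≤ a + b →
      ∃ q g : K[X], u = q * g ∧ q.natDegree ≤ a ∧ g.natDegree ≤ b := by
  intro a
  induction a with
  | zero => exact fun {u} _ hu => ⟨1, u, by simp, by simp, by simpa using hu⟩
  | succ a ih =>
    intro u hu0 hu
    by_cases hd : u.natDegree = 0
    · exact ⟨1, u, by simp, by simp, by omega⟩
    · obtain ⟨z, hz⟩ := IsAlgClosed.exists_root u (fun h => hd (natDegree_eq_of_degree_eq_some h))
      obtain ⟨u', rfl⟩ := dvd_iff_isRoot.2 hz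
      have hu' : u' ≠ 0 := right_ne_zero_of_mul hu0
      rw [natDegree_mul (X_sub_C_ne_zero z) hu', natDegree_X_sub_C] at hu
      obtain ⟨q, g, rfl, hq, hg⟩ := ih hu' (by omega)
      refine ⟨(X - C z) * q, g, by ring, ?_, hg⟩
      refine natDegree_mul_le.trans ?_
      rw [natDegree_X_sub_C]
      omega

/-- Over an algebraically closed field, some form of degree `d + 2` which vanishes at `d` given
points has a nonzero multiple in the span of `d + 1` independent forms of degree `d + 2 + k`. -/
theorem exists_form_vanishing {K : Type*} [Field K] [IsAlgClosed K] [DecidableEq K] (d k : ℕ)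
    {t : Fin d → K} (ht : Function.Injective t) {v : Fin (d + 1) → Fin (d + 2 + k + 1) → K}
    (hv : LinearIndependent K v) :
    ∃ (x : Fin (d + 2 + 1) → K) (c : Fin (k + 1) ⊕ Fin (d + 1) → K), x ≠ 0 ∧ c ≠ 0 ∧
      (bordered (d + 2) k (d + 1) x v).mulVec c = 0 ∧
      ∀ i, (ofFn (d + 2 + 1) x).eval (t i) = 0 := by
  let ev : (Fin (d + 1) → K) →ₗ[K] (Fin d → K) :=
    { toFun := fun a i => (ofFn (d + 2 + k + 1) (∑ j, a j • v j)).eval (t i)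
      map_add' := fun a b => by
        ext i
        simp [add_smul, Finset.sum_add_distrib]
      map_smul' := fun s a => by
        ext i
        simp only [Pi.smul_apply, smul_eq_mul, mul_smul, ← Finset.smul_sum, map_smul, eval_smul,
          RingHom.id_apply] }
  -- Vanishing at `d` points imposes `d` linear conditions on a space of dimension `d + 1`.
  obtain ⟨a, ha, ha0⟩ := Submodule.exists_mem_ne_zero_of_ne_bot
    (LinearMap.ker_ne_bot_of_finrank_lt (f := ev) (by simp))
  set w := ∑ j, a j • v j with hw
  have hw0 : w ≠ 0 := fun h0 =>
    ha0 (funext fun j => Fintype.linearIndependent_iff.1 hv a h0 j)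
  set W := ofFn (d + 2 + k + 1) w with hW
  have hW0 : W ≠ 0 := ofFn_ne_zero hw0
  have hroot : ∀ i, W.eval (t i) = 0 := fun i => congrFun (LinearMap.mem_ker.1 ha) i
  have hdvd : (∏ i, (X - C (t i))) ∣ W := by
    refine Finset.prod_dvd_of_coprime (fun i _ j _ hij => ?_) fun i _ => dvd_iff_isRoot.2 (hroot i)
    exact pairwise_coprime_X_sub_C ht hij
  obtain ⟨u, hu⟩ := hdvd
  have hu0 : u ≠ 0 := by
    rintro rfl
    exact hW0 (by rw [hu, mul_zero])
  have hprod0 : (∏ i, (X - C (t i))) ≠ 0 := Finset.prod_ne_zero_iff.2 fun i _ => X_sub_C_ne_zero _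
  have hprodd : (∏ i, (X - C (t i))).natDegree = d := by simp
  have hWd : W.natDegree < d + 2 + k + 1 := ofFn_natDegree_lt (by omega) w
  rw [hu, natDegree_mul hprod0 hu0, hprodd] at hWd
  -- The cofactor has degree at most `k + 2`. Two of its roots complete the `d` given points to a
  -- form of degree `d + 2`; the rest is the multiplier of degree `k`.
  obtain ⟨q, g, rfl, hq, hg⟩ := exists_eq_mul_of_natDegree_le k 2 hu0 (by omega)
  set p := (∏ i, (X - C (t i))) * q with hp
  have hp0 : p ≠ 0 := mul_ne_zero hprod0 (left_ne_zero_of_mul hu0)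
  have hpd : p.natDegree < d + 2 + 1 := by
    have : p.natDegree ≤ _ := natDegree_mul_le
    omega
  have hx : ofFn (d + 2 + 1) (toFn (d + 2 + 1) p) = p := ofFn_comp_toFn_eq_id_of_natDegree_lt hpd
  have hgg : ofFn (k + 1) (toFn (k + 1) g) = g := ofFn_comp_toFn_eq_id_of_natDegree_lt (by omega)
  refine ⟨toFn (d + 2 + 1) p, Sum.elim (toFn (k + 1) g) (-a), ?_, ?_, ?_, ?_⟩
  · intro h
    rw [h, map_zero] at hx
    exact hp0 hx.symm
  · intro h
    refine ha0 (neg_eq_zero.1 (funext fun j => congrFun h (Sum.inr j)))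
  · rw [bordered_mulVec]
    refine injective_ofFn _ ?_
    rw [map_add, map_zero]
    simp only [Sum.elim_inl, Sum.elim_inr, Pi.neg_apply, neg_smul, Finset.sum_neg_distrib, ← hw]
    rw [ofFn_multMatrix_mulVec, hx, hgg, map_neg, ← hW, hu, hp]
    ring
  · intro i
    rw [hx, hp, eval_mul, eval_prod, Finset.prod_eq_zero (Finset.mem_univ i) (by simp), zero_mul]

end Forms

/-! ### Standard charts as affine spaces, and homogenization. -/

section Charts

open MvPolynomial

variable {n : ℕ}

/-- Evaluation of degree zero fractions along a ring homomorphism that inverts `f`. -/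
def awayHom {B : Type*} [CommRing B] {f : MvPolynomial (Fin (n + 1)) ℂ}
    (φ : MvPolynomial (Fin (n + 1)) ℂ →+* B) (hf : IsUnit (φ f)) :
    HomogeneousLocalization.Away (grading n) f →+* B :=
  (Localization.awayLift φ f hf).comp
    (algebraMap (HomogeneousLocalization.Away (grading n) f) (Localization.Away f))

theorem awayHom_mk {B : Type*} [CommRing B] {f : MvPolynomial (Fin (n + 1)) ℂ}
    (φ : MvPolynomial (Fin (n + 1)) ℂ →+* B) (hf : IsUnit (φ f)) {d : ℕ} (hd : f ∈ grading n d)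
    (N : ℕ) (a : MvPolynomial (Fin (n + 1)) ℂ) (ha : a ∈ grading n (N • d)) :
    awayHom φ hf (HomogeneousLocalization.Away.mk (grading n) hd N a ha) * φ f ^ N = φ a := by
  rw [awayHom, RingHom.comp_apply, HomogeneousLocalization.algebraMap_apply,
    HomogeneousLocalization.Away.val_mk]
  obtain ⟨v, hv⟩ := hf.exists_right_inv
  rw [Localization.awayLift_mk (hv := hv), mul_assoc, ← mul_pow, mul_comm v, hv, one_pow, mul_one]

/-- The field of rational functions on the affine cone. -/
abbrev FunctionField (n : ℕ) : Type := FractionRing (MvPolynomial (Fin (n + 1)) ℂ)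

/-- Polynomials as rational functions. -/
abbrev toField (n : ℕ) : MvPolynomial (Fin (n + 1)) ℂ →+* FunctionField n := algebraMap _ _

theorem toField_injective (n : ℕ) : Function.Injective (toField n) :=
  IsFractionRing.injective _ _

theorem isUnit_toField {f : MvPolynomial (Fin (n + 1)) ℂ} (hf : f ≠ 0) :
    IsUnit (toField n f) :=
  isUnit_iff_ne_zero.2 fun h => hf (toField_injective n (by rw [h, map_zero]))

/-- Degree zero fractions as rational functions. -/
def awayVal {f : MvPolynomial (Fin (n + 1)) ℂ} (hf : f ≠ 0) :
    HomogeneousLocalization.Away (grading n) f →+* FunctionField n :=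
  awayHom (toField n) (isUnit_toField hf)

theorem awayVal_mk {f : MvPolynomial (Fin (n + 1)) ℂ} (hf : f ≠ 0) {d : ℕ}
    (hd : f ∈ grading n d) (N : ℕ) (a : MvPolynomial (Fin (n + 1)) ℂ)
    (ha : a ∈ grading n (N • d)) :
    awayVal hf (HomogeneousLocalization.Away.mk (grading n) hd N a ha) *
      toField n (f ^ N) = toField n a := by
  rw [map_pow]
  exact awayHom_mk _ (isUnit_toField hf) hd N a ha

theorem awayVal_injective {f : MvPolynomial (Fin (n + 1)) ℂ} (hf : f ≠ 0) {d : ℕ}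
    (hd : f ∈ grading n d) : Function.Injective (awayVal hf) := by
  rw [injective_iff_map_eq_zero]
  intro z hz
  obtain ⟨N, a, ha, rfl⟩ := HomogeneousLocalization.Away.mk_surjective (grading n) hd z
  have h1 := awayVal_mk hf hd N a ha
  rw [hz, zero_mul] at h1
  have h2 : a = 0 := toField_injective n (by rw [← h1, map_zero])
  apply HomogeneousLocalization.val_injective
  rw [HomogeneousLocalization.Away.val_mk, HomogeneousLocalization.val_zero, h2,
    Localization.mk_zero]

/-- Finitely many degree zero fractions have a common denominator. -/
theorem exists_awayVal_mul_eq {ι : Type*} [Finite ι] {f : MvPolynomial (Fin (n + 1)) ℂ}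
    (hf : f ≠ 0) {d : ℕ} (hd : f ∈ grading n d)
    (z : ι → HomogeneousLocalization.Away (grading n) f) :
    ∃ N₀, ∀ N ≥ N₀, ∃ A : ι → MvPolynomial (Fin (n + 1)) ℂ, ∀ m, A m ∈ grading n (N • d) ∧
      awayVal hf (z m) * toField n (f ^ N) = toField n (A m) := by
  have := Fintype.ofFinite ι
  choose e a ha hz using fun m => HomogeneousLocalization.Away.mk_surjective (grading n) hd (z m)
  refine ⟨Finset.univ.sup e, fun N hN => ⟨fun m => f ^ (N - e m) * a m, fun m => ?_⟩⟩
  have h1 : N - e m + e m = N := Nat.sub_add_cancel ((Finset.le_sup (Finset.mem_univ m)).trans hN)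
  constructor
  · have h2 := SetLike.mul_mem_graded (SetLike.pow_mem_graded (N - e m) hd) (ha m)
    rwa [← add_smul, h1] at h2
  · have h2 := awayVal_mk hf hd (e m) (a m) (ha m)
    rw [hz m] at h2
    rw [map_mul, ← h2, mul_left_comm, ← map_mul, ← pow_add, h1]

/-- Functions on a chart as rational functions. -/
def chartVal (i : Fin (n + 1)) : Chart n i →+* FunctionField n := awayVal (X_ne_zero i)

theorem chartVal_injective (i : Fin (n + 1)) : Function.Injective (chartVal i) :=
  awayVal_injective _ (X_mem n i)

instance isDomainChart (i : Fin (n + 1)) : IsDomain (Chart n i) :=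
  (chartVal_injective i).isDomain (chartVal i)

theorem chartVal_dehom {d : ℕ} (F : MvPolynomial (Fin (n + 1)) ℂ) (hF : F.IsHomogeneous d)
    (i : Fin (n + 1)) :
    chartVal i (dehom F hF i) * toField n (X i ^ d) = toField n F :=
  awayVal_mk _ _ _ _ _

/-- Functions on the overlap of two charts as rational functions. -/
def overlapVal (i j : Fin (n + 1)) : Overlap n i j →+* FunctionField n :=
  awayVal (mul_ne_zero (X_ne_zero i) (X_ne_zero j))

theorem toField_pow_X_ne_zero (i : Fin (n + 1)) (N : ℕ) :
    toField n (X i ^ N) ≠ 0 :=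
  (isUnit_toField (pow_ne_zero N (X_ne_zero i))).ne_zero

theorem overlapVal_resL (i j : Fin (n + 1)) (z : Chart n i) :
    overlapVal i j (resL n i j z) = chartVal i z := by
  obtain ⟨N, a, ha, rfl⟩ := HomogeneousLocalization.Away.mk_surjective (grading n) (X_mem n i) z
  refine mul_right_cancel₀ (toField_pow_X_ne_zero i N) ?_
  rw [chartVal, awayVal_mk]
  refine mul_right_cancel₀ (toField_pow_X_ne_zero j N) ?_
  rw [resL, HomogeneousLocalization.awayMap_mk, mul_assoc, ← map_mul, ← mul_pow, ← map_mul]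
  exact awayVal_mk _ _ _ _ _

theorem overlapVal_resR (i j : Fin (n + 1)) (z : Chart n j) :
    overlapVal i j (resR n i j z) = chartVal j z := by
  obtain ⟨N, a, ha, rfl⟩ := HomogeneousLocalization.Away.mk_surjective (grading n) (X_mem n j) z
  refine mul_right_cancel₀ (toField_pow_X_ne_zero j N) ?_
  rw [chartVal, awayVal_mk]
  refine mul_right_cancel₀ (toField_pow_X_ne_zero i N) ?_
  rw [resR, HomogeneousLocalization.awayMap_mk, mul_assoc, ← map_mul, ← mul_pow, ← map_mul,
    show (X j * X i : MvPolynomial (Fin (n + 1)) ℂ) ^ N = (X i * X j) ^ N by rw [mul_comm]]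
  exact awayVal_mk _ _ _ _ _

/-- Dehomogenization, `x_m ↦ x_m / x_i`. -/
def toChart (i : Fin (n + 1)) : MvPolynomial (Fin (n + 1)) ℂ →ₐ[ℂ] Chart n i :=
  aeval (ratio n i)

theorem toChart_X (i m : Fin (n + 1)) : toChart i (X m) = ratio n i m := aeval_X _ _

theorem toChart_C (i : Fin (n + 1)) (c : ℂ) : toChart i (C c) = algebraMap ℂ _ c :=
  aeval_C _ _

theorem algebraMap_eq_dehom (i : Fin (n + 1)) (c : ℂ) :
    algebraMap ℂ (Chart n i) c = dehom (C c) (isHomogeneous_C _ c) i := by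
  apply HomogeneousLocalization.val_injective
  rfl

theorem chartVal_algebraMap (i : Fin (n + 1)) (c : ℂ) :
    chartVal i (algebraMap ℂ _ c) = toField n (C c) := by
  rw [algebraMap_eq_dehom]
  simpa using chartVal_dehom (C c) (isHomogeneous_C _ c) i

theorem chartVal_ratio (i m : Fin (n + 1)) :
    chartVal i (ratio n i m) * toField n (X i) = toField n (X m) := by
  simpa [ratio] using chartVal_dehom (X m) (isHomogeneous_X ℂ m) i

theorem eval₂_mul_pow {B : Type*} [CommRing B] {d : ℕ} {F : MvPolynomial (Fin (n + 1)) ℂ}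
    (hF : F.IsHomogeneous d) (φ : ℂ →+* B) (y : Fin (n + 1) → B) (u : B) :
    eval₂ φ y F * u ^ d = eval₂ φ (fun m => y m * u) F := by
  rw [eval₂_eq', eval₂_eq', Finset.sum_mul]
  refine Finset.sum_congr rfl fun a ha => ?_
  have h1 : ∑ m, a m = d := by
    rw [← Finsupp.degree_eq_sum]
    exact (hF.degree_eq_sum_deg_support ha).symm
  simp only [mul_pow, Finset.prod_mul_distrib, Finset.prod_pow_eq_pow_sum, h1, mul_assoc]

theorem chartVal_toChart {d : ℕ} {F : MvPolynomial (Fin (n + 1)) ℂ} (hF : F.IsHomogeneous d)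
    (i : Fin (n + 1)) :
    chartVal i (toChart i F) * toField n (X i ^ d) = toField n F := by
  have h1 : chartVal i (toChart i F) = eval₂ ((toField n).comp C)
      (fun m => chartVal i (ratio n i m)) F := by
    rw [toChart, aeval_def, eval₂_comp_left]
    congr 1
    ext c
    exact chartVal_algebraMap i c
  rw [h1, map_pow, eval₂_mul_pow hF]
  simp only [chartVal_ratio]
  have h2 := eval₂_comp_left (toField n) C (X : Fin (n + 1) → _) F
  rw [eval₂_eta] at h2
  exact h2.symm

theorem toChart_eq_iff {d : ℕ} {F : MvPolynomial (Fin (n + 1)) ℂ} (hF : F.IsHomogeneous d)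
    (i : Fin (n + 1)) (z : Chart n i) : toChart i F = z ↔
      chartVal i z * toField n (X i ^ d) = toField n F := by
  rw [← chartVal_toChart hF i, mul_left_inj' (toField_pow_X_ne_zero i d),
    (chartVal_injective i).eq_iff, eq_comm]

theorem toChart_eq_dehom {d : ℕ} (F : MvPolynomial (Fin (n + 1)) ℂ) (hF : F.IsHomogeneous d)
    (i : Fin (n + 1)) : toChart i F = dehom F hF i :=
  (toChart_eq_iff hF i _).2 (chartVal_dehom F hF i)

theorem toChart_eq_zero_iff {d : ℕ} {F : MvPolynomial (Fin (n + 1)) ℂ} (hF : F.IsHomogeneous d)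
    (i : Fin (n + 1)) : toChart i F = 0 ↔ F = 0 := by
  rw [toChart_eq_iff hF, map_zero, zero_mul, eq_comm, map_eq_zero_iff _
    (toField_injective n)]

/-- Finitely many functions on a chart are dehomogenizations of forms of the same degree. -/
theorem exists_toChart_eq {ι : Type*} [Finite ι] (i : Fin (n + 1)) (z : ι → Chart n i) :
    ∃ N₀, ∀ N ≥ N₀, ∃ A : ι → MvPolynomial (Fin (n + 1)) ℂ, ∀ m, (A m).IsHomogeneous N ∧
      toChart i (A m) = z m := by
  obtain ⟨N₀, h⟩ := exists_awayVal_mul_eq (X_ne_zero i) (X_mem n i) z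
  refine ⟨N₀, fun N hN => ?_⟩
  obtain ⟨A, hA⟩ := h N hN
  have h1 : ∀ m, (A m).IsHomogeneous N := fun m => by simpa using (hA m).1
  exact ⟨A, fun m => ⟨h1 m, (toChart_eq_iff (h1 m) i _).2 (hA m).2⟩⟩

theorem toChart_surjective (i : Fin (n + 1)) : Function.Surjective (toChart i) := fun z => by
  obtain ⟨N, h⟩ := exists_toChart_eq i fun _ : Unit => z
  obtain ⟨A, hA⟩ := h N le_rfl
  exact ⟨A (), (hA ()).2⟩

theorem ratio_self (i : Fin (n + 1)) : ratio n i i = 1 := by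
  rw [← toChart_X, toChart_eq_iff (isHomogeneous_X ℂ i), map_one, one_mul, pow_one]

/-- The substitution `x_i ↦ 1`. -/
def evalOne (i : Fin (n + 1)) :
    MvPolynomial (Fin (n + 1)) ℂ →ₐ[ℂ] MvPolynomial {m : Fin (n + 1) // m ≠ i} ℂ :=
  aeval fun m => if h : m = i then 1 else X ⟨m, h⟩

theorem evalOne_X_self (i : Fin (n + 1)) : evalOne i (X i) = 1 := by simp [evalOne]

/-- Polynomials in the affine coordinates as functions on a chart. -/
def affineToChart (i : Fin (n + 1)) :
    MvPolynomial {m : Fin (n + 1) // m ≠ i} ℂ →ₐ[ℂ] Chart n i :=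
  aeval fun m => ratio n i m

theorem affineToChart_evalOne (i : Fin (n + 1)) (F : MvPolynomial (Fin (n + 1)) ℂ) :
    affineToChart i (evalOne i F) = toChart i F := by
  have : (affineToChart i).comp (evalOne i) = toChart i := by
    ext m
    by_cases h : m = i
    · subst h
      simp [evalOne, toChart_X, ratio_self]
    · simp [evalOne, h, affineToChart, toChart_X]
  rw [← this]
  rfl

/-- Substituting 1 for `x_i` inverts `x_i`, hence extends to the chart and gives a left inverse;
surjectivity comes from dehomogenizing forms. -/
theorem affineToChart_bijective (i : Fin (n + 1)) : Function.Bijective (affineToChart i) := by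
  constructor
  · have hu : IsUnit ((evalOne i).toRingHom (X i)) := by
      rw [AlgHom.toRingHom_eq_coe, RingHom.coe_coe, evalOne_X_self]
      exact isUnit_one
    let ψ : Chart n i →+* MvPolynomial {m : Fin (n + 1) // m ≠ i} ℂ :=
      awayHom (evalOne i).toRingHom hu
    have h1 : ∀ {d : ℕ} (F : MvPolynomial (Fin (n + 1)) ℂ) (hF : F.IsHomogeneous d),
        ψ (dehom F hF i) = evalOne i F := fun F hF => by
      have := awayHom_mk (evalOne i).toRingHom hu (X_mem n i) _ F
        (by simpa using hF)
      have h : (evalOne i).toRingHom (X i) = 1 := evalOne_X_self i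
      rwa [h, one_pow, mul_one] at this
    have h2 : ψ.comp (affineToChart i : _ →+* Chart n i) = RingHom.id _ := by
      refine ringHom_ext (fun c => ?_) fun m => ?_
      · simp only [RingHom.comp_apply, RingHom.coe_coe, affineToChart, aeval_C, RingHom.id_apply]
        rw [algebraMap_eq_dehom, h1]
        exact (evalOne i).commutes c
      · simp only [RingHom.comp_apply, RingHom.coe_coe, affineToChart, aeval_X, RingHom.id_apply]
        rw [ratio, h1]
        simp [evalOne, m.2]
    exact Function.LeftInverse.injective (g := ψ) fun F => RingHom.congr_fun h2 F
  · intro z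
    obtain ⟨F, rfl⟩ := toChart_surjective i z
    exact ⟨evalOne i F, affineToChart_evalOne i F⟩

/-- A chart of projective space is an affine space. -/
def chartEquiv (i : Fin (n + 1)) : Chart n i ≃ₐ[ℂ] MvPolynomial {m : Fin (n + 1) // m ≠ i} ℂ :=
  (AlgEquiv.ofBijective (affineToChart i) (affineToChart_bijective i)).symm

theorem chartEquiv_symm_X (i : Fin (n + 1)) (m : {m : Fin (n + 1) // m ≠ i}) :
    (chartEquiv i).symm (X m) = ratio n i m := by
  simp [chartEquiv, affineToChart]

instance uniqueFactorizationMonoidChart (i : Fin (n + 1)) :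
    UniqueFactorizationMonoid (Chart n i) :=
  (chartEquiv i).symm.toMulEquiv.uniqueFactorizationMonoid inferInstance

end Charts

/-! ### Global sections of the Schwarzenberger bundle. -/

section Sections

open MvPolynomial

variable {n k : ℕ}

theorem multMatrix_toChart (k : ℕ) (i : Fin (n + 1)) :
    (multMatrix n k (X : Fin (n + 1) → MvPolynomial (Fin (n + 1)) ℂ)).map (toChart i) =
      multMatrix n k (ratio n i) := by
  have h := multMatrix_map n k X (ratio n i) (toChart i).toRingHom 1
    fun j => by rw [one_mul]; exact toChart_X i j
  rwa [one_smul] at h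

theorem toChart_multMatrix_mulVec (i : Fin (n + 1))
    (c : Fin (k + 1) → MvPolynomial (Fin (n + 1)) ℂ) (m : Fin (n + k + 1)) :
    toChart i ((multMatrix n k X).mulVec c m) =
      (multMatrix n k (ratio n i)).mulVec (fun l => toChart i (c l)) m := by
  rw [← multMatrix_toChart]
  exact RingHom.map_mulVec (toChart i).toRingHom _ _ _

theorem not_X_dvd_X {i j : Fin (n + 1)} (h : j ≠ i) :
    ¬ (X i : MvPolynomial (Fin (n + 1)) ℂ) ∣ X j := fun hd => by
  rw [X_dvd_X] at hd
  exact h hd.symm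

theorem exists_not_X_dvd_X (hn : 1 ≤ n) (i : Fin (n + 1)) :
    ∃ j, ¬ (X i : MvPolynomial (Fin (n + 1)) ℂ) ∣ X j := by
  have : Nontrivial (Fin (n + 1)) := Fin.nontrivial_iff_two_le.2 (by omega)
  obtain ⟨j, hj⟩ := exists_ne i
  exact ⟨j, not_X_dvd_X hj⟩

theorem mem_range_multMatrix_of_X_pow_smul_mem (hn : 1 ≤ n) (i : Fin (n + 1)) (q : ℕ)
    {g : Fin (n + k + 1) → MvPolynomial (Fin (n + 1)) ℂ}
    (hg : (X i : MvPolynomial (Fin (n + 1)) ℂ) ^ q • g ∈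
      LinearMap.range (multMatrix n k X).mulVecLin) :
    g ∈ LinearMap.range (multMatrix n k X).mulVecLin :=
  mem_range_of_pow_smul_mem (X_ne_zero i)
    (fun c h l => dvd_of_dvd_multMatrix_mulVec X_prime (exists_not_X_dvd_X hn i) c h l) q hg

/-- Sections over two charts that agree on the overlap, in homogeneous coordinates. -/
theorem smul_sub_smul_mem_range (hn : 1 ≤ n) {i j : Fin (n + 1)} {N : ℕ}
    {A B : Fin (n + k + 1) → MvPolynomial (Fin (n + 1)) ℂ} (hA : ∀ m, (A m).IsHomogeneous N)
    (hB : ∀ m, (B m).IsHomogeneous N)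
    (h : secResL n k i j (Submodule.Quotient.mk fun m => toChart i (A m)) =
      secResR n k i j (Submodule.Quotient.mk fun m => toChart j (B m))) :
    (X j ^ N : MvPolynomial (Fin (n + 1)) ℂ) • A - (X i ^ N : MvPolynomial (Fin (n + 1)) ℂ) • B ∈
      LinearMap.range (multMatrix n k X).mulVecLin := by
  obtain ⟨b, hb⟩ := (Submodule.Quotient.eq _).1 h
  obtain ⟨e, he⟩ := exists_awayVal_mul_eq (mul_ne_zero (X_ne_zero i) (X_ne_zero j))
    (SetLike.mul_mem_graded (X_mem n i) (X_mem n j)) b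
  obtain ⟨B', hB'⟩ := he e le_rfl
  have h1 : ∀ l, overlapVal i j (b l) * toField n ((X i * X j) ^ e) = toField n (B' l) :=
    fun l => (hB' l).2
  set y : Fin (n + 1) → Overlap n i j := fun m => resL n i j (ratio n i m) with hy
  have h2 : ∀ m l, overlapVal i j (multMatrix n k y m l) * toField n (X i) =
      toField n (multMatrix n k X m l) := fun m l => by
    have h3 := multMatrix_map n k y (overlapVal i j ∘ y) (overlapVal i j) 1 (by simp)
    have h4 := multMatrix_map n k X (overlapVal i j ∘ y) (toField n) (toField n (X i))
      fun j' => by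
        rw [Function.comp_apply, hy, overlapVal_resL, mul_comm, chartVal_ratio]
    have h5 := congrFun (congrFun h3 m) l
    have h6 := congrFun (congrFun h4 m) l
    simp only [Matrix.map_apply, Matrix.smul_apply, smul_eq_mul, one_mul] at h5 h6
    rw [h5, h6, mul_comm]
  -- The exponent `e` clears the denominators of the coefficients `b`. The extra factor `x_i`
  -- appears because the matrix on the overlap is normalized by `x_i`.
  refine mem_range_multMatrix_of_X_pow_smul_mem hn i (e + 1)
    (mem_range_multMatrix_of_X_pow_smul_mem hn j e
      ⟨(X i ^ N * X j ^ N : MvPolynomial (Fin (n + 1)) ℂ) • B', ?_⟩)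
  ext1 m
  apply toField_injective
  have h3 : ∑ l, overlapVal i j (multMatrix n k y m l) * overlapVal i j (b l) =
      chartVal i (toChart i (A m)) - chartVal j (toChart j (B m)) := by
    have h4 := congrArg (overlapVal i j) (congrFun hb m)
    simp only [Matrix.mulVecLin_apply, Matrix.mulVec, dotProduct, map_sum, map_mul] at h4
    rw [h4]
    change overlapVal i j (resL n i j _ - resR n i j _) = _
    rw [map_sub, overlapVal_resL, overlapVal_resR]
  have hA' := chartVal_toChart (hA m) i
  have hB' := chartVal_toChart (hB m) j
  rw [map_smul, Matrix.mulVecLin_apply]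
  simp only [Pi.smul_apply, Pi.sub_apply, smul_eq_mul, map_mul, map_sub, Matrix.mulVec,
    dotProduct, map_sum, ← h1, ← h2, ← hA', ← hB', map_pow]
  have h4 := congrArg (fun z => z * (toField n (X i) ^ (N + e + 1) * toField n (X j) ^ (N + e))) h3
  simp only [Finset.sum_mul] at h4
  rw [Finset.mul_sum]
  refine (Finset.sum_congr rfl fun l _ => ?_).trans (h4.trans ?_)
  · ring
  · ring

theorem multMatrix_isHomogeneous (m : Fin (n + k + 1)) (l : Fin (k + 1)) :
    (multMatrix n k (X : Fin (n + 1) → MvPolynomial (Fin (n + 1)) ℂ) m l).IsHomogeneous 1 := by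
  rw [multMatrix, Matrix.of_apply]
  refine IsHomogeneous.sum _ _ _ fun j _ => ?_
  split_ifs
  · exact isHomogeneous_X ℂ j
  · exact isHomogeneous_zero _ _ _

theorem homogeneousComponent_mul_of_isHomogeneous {σ R : Type*} [CommRing R] {a b : ℕ}
    {p q : MvPolynomial σ R} (hp : p.IsHomogeneous a) :
    homogeneousComponent (a + b) (p * q) = p * homogeneousComponent b q := by
  classical
  conv_lhs => rw [← sum_homogeneousComponent q, Finset.mul_sum, map_sum]
  have h1 : ∀ i, homogeneousComponent (a + b) (p * homogeneousComponent i q) =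
      if i = b then p * homogeneousComponent i q else 0 := fun i => by
    rw [homogeneousComponent_of_mem (hp.mul (homogeneousComponent_isHomogeneous i q))]
    simp only [Nat.add_left_cancel_iff, eq_comm]
  simp only [h1, Finset.sum_ite_eq', Finset.mem_range]
  split_ifs with h
  · rfl
  · rw [homogeneousComponent_eq_zero _ _ (by omega), mul_zero]

/-- Membership in a monomial ideal is tested on exponents, and multiplication by powers of `x_c`
does not change the exponents at `a` and `b`. -/
theorem mem_span_of_X_pow_mul_mem {a b c : Fin (n + 1)} (hac : a ≠ c) (hbc : b ≠ c) (N : ℕ)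
    {p : MvPolynomial (Fin (n + 1)) ℂ} (h : X c ^ N * p ∈ Ideal.span {X a ^ N, X b ^ N}) :
    p ∈ Ideal.span {X a ^ N, (X b ^ N : MvPolynomial (Fin (n + 1)) ℂ)} := by
  have h1 : ({X a ^ N, X b ^ N} : Set (MvPolynomial (Fin (n + 1)) ℂ)) =
      (fun s => monomial s 1) '' {Finsupp.single a N, Finsupp.single b N} := by
    rw [Set.image_pair, X_pow_eq_monomial, X_pow_eq_monomial]
  rw [h1, mem_ideal_span_monomial_image] at h ⊢
  intro u hu
  obtain ⟨s, hs, hle⟩ := h (Finsupp.single c N + u) (by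
    rw [mem_support_iff, X_pow_eq_monomial, coeff_monomial_mul, one_mul]
    exact mem_support_iff.1 hu)
  refine ⟨s, hs, ?_⟩
  rcases hs with rfl | rfl
  · have := hle a
    rw [Finsupp.single_le_iff]
    simpa [Finsupp.single_apply, hac.symm] using this
  · have := hle b
    rw [Finsupp.single_le_iff]
    simpa [Finsupp.single_apply, hbc.symm] using this

theorem X_pow_dvd_of_dvd_X_pow_mul {a b : Fin (n + 1)} (hab : b ≠ a) (N : ℕ)
    {p : MvPolynomial (Fin (n + 1)) ℂ} (h : X a ^ N ∣ X b ^ N * p) : X a ^ N ∣ p :=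
  X_prime.pow_dvd_of_dvd_mul_left N (fun hd => not_X_dvd_X hab (X_prime.dvd_of_dvd_pow hd)) h

/-- The sections of the Schwarzenberger bundle given by binary forms of degree `n + k`. -/
def constSection (n k : ℕ) : (Fin (n + k + 1) → ℂ) →ₗ[ℂ] globalSections n k where
  toFun c := ⟨fun i => Submodule.Quotient.mk fun m => algebraMap ℂ (Chart n i) (c m), fun i j => by
    change (Submodule.Quotient.mk (fun m => resL n i j (algebraMap ℂ _ (c m))) :
      OverlapSections n k i j) = Submodule.Quotient.mk fun m => resR n i j (algebraMap ℂ _ (c m))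
    simp only [resL_algebraMap, resR_algebraMap]⟩
  map_add' c d := by
    ext i
    simp only [Pi.add_apply, map_add]
    rfl
  map_smul' a c := by
    ext i
    simp only [Pi.smul_apply, smul_eq_mul, map_mul]
    change (Submodule.Quotient.mk _ : ChartSections n k i) = a • Submodule.Quotient.mk _
    rw [← Submodule.Quotient.mk_smul]
    congr 1
    funext m
    exact (Algebra.smul_def a (algebraMap ℂ (Chart n i) (c m))).symm

theorem constSection_apply (c : Fin (n + k + 1) → ℂ) (i : Fin (n + 1)) :
    (constSection n k c : ∀ i, ChartSections n k i) i =
      Submodule.Quotient.mk fun m => algebraMap ℂ (Chart n i) (c m) := rfl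

/-- A global section is determined by its restriction to a chart. -/
theorem section_ext (hn : 1 ≤ n) {s t : globalSections n k} {i : Fin (n + 1)}
    (hi : (s : ∀ i, ChartSections n k i) i = (t : ∀ i, ChartSections n k i) i) : s = t := by
  refine Subtype.ext (funext fun j => sub_eq_zero.1 ?_)
  obtain ⟨f, hf⟩ := Submodule.Quotient.mk_surjective _
    ((s : ∀ i, ChartSections n k i) j - (t : ∀ i, ChartSections n k i) j)
  -- The difference vanishes over chart `i`, so it is compared there with the representative 0.
  -- Torsion-freeness of the cokernel then kills it over chart `j`.
  obtain ⟨N, hN⟩ := exists_toChart_eq j f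
  obtain ⟨A, hA⟩ := hN N le_rfl
  have hAf : (fun m => toChart j (A m)) = f := funext fun m => (hA m).2
  have h1 := smul_sub_smul_mem_range (k := k) hn (i := i) (j := j) (N := N) (A := 0) (B := A)
    (fun m => isHomogeneous_zero _ _ _) (fun m => (hA m).1) (by
      rw [hAf, hf, map_sub, ← s.2 i j, ← t.2 i j, hi, sub_self]
      have : (fun m => toChart i ((0 : Fin (n + k + 1) → MvPolynomial (Fin (n + 1)) ℂ) m)) = 0 := by
        ext m
        simp
      rw [this, Submodule.Quotient.mk_zero, map_zero])
  rw [smul_zero, zero_sub, neg_mem_iff] at h1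
  obtain ⟨c, hc⟩ := mem_range_multMatrix_of_X_pow_smul_mem hn i N h1
  rw [← hf, Submodule.Quotient.mk_eq_zero]
  refine ⟨fun l => toChart j (c l), ?_⟩
  ext m
  rw [Matrix.mulVecLin_apply, ← toChart_multMatrix_mulVec, ← hAf, ← hc]
  rfl

/-- Every global section of the Schwarzenberger bundle is given by a binary form. -/
theorem constSection_surjective (hn : 2 ≤ n) : Function.Surjective (constSection n k) := by
  intro s
  choose f hf using fun i => Submodule.Quotient.mk_surjective _ ((s : ∀ i, ChartSections n k i) i)
  choose N₀ hN₀ using fun i => exists_toChart_eq i (f i)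
  -- The `+ 1` ensures `N ≥ 1`, so that components of degree `N - 1` can be taken below.
  let N := Finset.univ.sup N₀ + 1
  choose A hA using fun i =>
    hN₀ i N ((Finset.le_sup (f := N₀) (Finset.mem_univ i)).trans (Nat.le_succ _))
  have hAf : ∀ i, (fun m => toChart i (A i m)) = f i := fun i => funext fun m => (hA i m).2
  have h1 : ∀ i j, (X j ^ N : MvPolynomial (Fin (n + 1)) ℂ) • A i -
      (X i ^ N : MvPolynomial (Fin (n + 1)) ℂ) • A j ∈
        LinearMap.range (multMatrix n k X).mulVecLin := fun i j =>
    smul_sub_smul_mem_range (by omega) (fun m => (hA i m).1) (fun m => (hA j m).1) (by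
      rw [hAf, hAf, hf, hf]
      exact s.2 i j)
  let i₀ : Fin (n + 1) := ⟨0, by omega⟩
  let i₁ : Fin (n + 1) := ⟨1, by omega⟩
  let i₂ : Fin (n + 1) := ⟨2, by omega⟩
  have h01 : i₁ ≠ i₀ := by simp [i₀, i₁]
  have h02 : i₀ ≠ i₂ := by simp [i₀, i₂]
  have h12 : i₁ ≠ i₂ := by simp [i₁, i₂]
  obtain ⟨B, c, hB⟩ := exists_eq_smul_add_of_cocycle
    (fun c => multMatrix_mulVec_injective (fun h => X_ne_zero i₀ (congrFun h i₀)))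
    (fun b => X_pow_dvd_of_dvd_X_pow_mul h01 N) (fun b => mem_span_of_X_pow_mul_mem h02 h12 N)
    (h1 i₀ i₁) (h1 i₀ i₂) (h1 i₁ i₂)
  -- In degree `N`, the equation for `A i₀` sees only the constant part of `B`, together with the
  -- degree `N - 1` part of `c`, since the matrix is linear in the coordinates.
  refine ⟨fun m => coeff 0 (B m), ?_⟩
  refine (section_ext (by omega) (i := i₀) ?_).symm
  rw [constSection_apply, ← hf, ← hAf]
  refine (Submodule.Quotient.eq _).2 ?_
  refine ⟨fun l => toChart i₀ (homogeneousComponent (N - 1) (c l)), ?_⟩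
  ext m
  rw [Matrix.mulVecLin_apply, ← toChart_multMatrix_mulVec]
  have h2 := congrArg (homogeneousComponent N) (congrFun hB m)
  have h3 : homogeneousComponent N (A i₀ m) = A i₀ m := homogeneousComponent_eq_self (hA i₀ m).1
  have h4 : homogeneousComponent N (X i₀ ^ N * B m) = X i₀ ^ N * C (coeff 0 (B m)) := by
    rw [← homogeneousComponent_zero]
    exact homogeneousComponent_mul_of_isHomogeneous (b := 0) (by
      simpa using (isHomogeneous_X ℂ i₀).pow N)
  have h5 : homogeneousComponent N ((multMatrix n k X).mulVec c m) =
      (multMatrix n k X).mulVec (fun l => homogeneousComponent (N - 1) (c l)) m := by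
    simp only [Matrix.mulVec, dotProduct, map_sum]
    refine Finset.sum_congr rfl fun l _ => ?_
    rw [← homogeneousComponent_mul_of_isHomogeneous (multMatrix_isHomogeneous m l),
      Nat.add_sub_cancel' (by omega)]
  rw [Pi.add_apply, Pi.smul_apply, smul_eq_mul, map_add, h3, h4, h5] at h2
  rw [Pi.sub_apply, h2, map_add, map_mul, map_pow, toChart_X, ratio_self, one_pow, one_mul,
    toChart_C, add_sub_cancel_left]

end Sections

/-! ### Degeneracy loci of `n - 1` independent sections have codimension 2. -/

section Codimension

open MvPolynomial

theorem minorIdeal_mk {A : Type*} [CommRing A] (n k r : ℕ) (x : Fin (n + 1) → A)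
    (f : Fin r → Fin (n + k + 1) → A) :
    minorIdeal n k r x (fun a => Submodule.Quotient.mk (f a)) =
      Ideal.span {d : A | ∃ e : Fin (k + 1) ⊕ Fin r → Fin (n + k + 1),
        d = ((bordered n k r x f).submatrix e id).det} := by
  rw [minorIdeal]
  congr 1
  ext d
  constructor
  · rintro ⟨g, e, hg, rfl⟩
    exact ⟨e, det_bordered_congr n k r x g f hg e⟩
  · rintro ⟨e, rfl⟩
    exact ⟨f, e, fun _ => rfl, rfl⟩

/-- The matrix of the multiplication of forms bordered by constant columns. -/
def constBordered {A : Type*} [CommRing A] [Algebra ℂ A] {n k r : ℕ} (x : Fin (n + 1) → A)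
    (v : Fin r → Fin (n + k + 1) → ℂ) : Matrix (Fin (n + k + 1)) (Fin (k + 1) ⊕ Fin r) A :=
  bordered n k r x fun a => algebraMap ℂ A ∘ v a

theorem constBordered_map {A B : Type*} [CommRing A] [Algebra ℂ A] [CommRing B] [Algebra ℂ B]
    {n k r : ℕ} (x : Fin (n + 1) → A) (v : Fin r → Fin (n + k + 1) → ℂ) (φ : A →ₐ[ℂ] B) :
    (constBordered x v).map φ = constBordered (φ ∘ x) v := by
  have h := bordered_map n k r x (fun a => algebraMap ℂ A ∘ v a) (φ : A →+* B)
  have h2 : ∀ a, (φ : A →+* B) ∘ algebraMap ℂ A ∘ v a = algebraMap ℂ B ∘ v a := fun a => by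
    ext m
    simp
  simp only [h2] at h
  exact h

theorem degeneracyScheme_constSection_ideal {n k r : ℕ} (v : Fin r → Fin (n + k + 1) → ℂ)
    (i : Fin (n + 1)) :
    (degeneracyScheme n k r fun a => constSection n k (v a)).ideal i =
      Ideal.span {d : Chart n i | ∃ e : Fin (k + 1) ⊕ Fin r → Fin (n + k + 1),
        d = ((constBordered (ratio n i) v).submatrix e id).det} :=
  minorIdeal_mk n k r (ratio n i) _

/-- An indexing of the rows of `N` with one additional column. -/
def rowEquiv (r k : ℕ) : Option (Fin (k + 1) ⊕ Fin r) ≃ Fin (r + 1 + k + 1) :=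
  Fintype.equivOfCardEq (by simp; omega)

/-- The minors of `r` sections of the bundle of rank `r + 1`, as the values of a linear form. -/
abbrev minorForm {A : Type*} [CommRing A] [Algebra ℂ A] {k r : ℕ} (x : Fin (r + 1 + 1) → A)
    (v : Fin r → Fin (r + 1 + k + 1) → ℂ) : (Fin (r + 1 + k + 1) → A) →ₗ[A] A :=
  colDet (constBordered x v) (rowEquiv r k)

theorem degeneracyScheme_ideal_eq_range {k r : ℕ} (v : Fin r → Fin (r + 1 + k + 1) → ℂ)
    (i : Fin (r + 1 + 1)) :
    (degeneracyScheme (r + 1) k r fun a => constSection (r + 1) k (v a)).ideal i =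
      LinearMap.range (minorForm (ratio (r + 1) i) v) := by
  rw [degeneracyScheme_constSection_ideal]
  exact span_minors_eq_range _ _

theorem map_minorForm {A B : Type*} [CommRing A] [Algebra ℂ A] [CommRing B] [Algebra ℂ B]
    {k r : ℕ} (x : Fin (r + 1 + 1) → A) (v : Fin r → Fin (r + 1 + k + 1) → ℂ) (φ : A →ₐ[ℂ] B)
    (w : Fin (r + 1 + k + 1) → A) :
    φ (minorForm x v w) = minorForm (φ ∘ x) v (φ ∘ w) := by
  have h := map_colDet (φ : A →+* B) (constBordered x v) (rowEquiv r k) w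
  rw [RingHom.coe_coe, constBordered_map] at h
  exact h

/-- The coordinates of a point where `r` independent sections are dependent have transcendence
degree less than `r`. -/
theorem exists_isAlgebraic_of_minorForm {A L : Type*} [CommRing A] [Algebra ℂ A] [Field L]
    [Algebra ℂ L] {k r : ℕ} {x : Fin (r + 1 + 1) → A} {v : Fin r → Fin (r + 1 + k + 1) → ℂ}
    (hv : LinearIndependent ℂ v) (φ : A →ₐ[ℂ] L) (h : ∀ w, φ (minorForm x v w) = 0)
    {i : Fin (r + 1 + 1)} (hi : φ (x i) ≠ 0) :
    ∃ T : Finset L, T.card < r ∧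
      ∀ m, IsAlgebraic (IntermediateField.adjoin ℂ (T : Set L)) (φ (x m) / φ (x i)) := by
  have h1 : minorForm (φ ∘ x) v = 0 := by
    refine LinearMap.pi_ext' fun m => LinearMap.ext_ring ?_
    have h2 := h (Pi.single m 1)
    rw [map_minorForm] at h2
    rw [LinearMap.comp_apply, LinearMap.zero_comp, LinearMap.zero_apply, LinearMap.single_apply,
      ← h2]
    congr 1
    ext m'
    by_cases hm : m' = m
    · subst hm
      simp
    · simp [hm]
  obtain ⟨c, hc, h2⟩ := exists_mulVec_eq_zero_of_colDet _ (rowEquiv r k)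
    fun w => LinearMap.congr_fun h1 w
  exact exists_isAlgebraic_div hv hi hc h2

/-- All but one of the coordinates stay independent modulo `p`, so a set over which all the
coordinates are algebraic has at least `card σ - 1` elements. -/
theorem card_le_of_prime {A σ : Type*} [CommRing A] [Algebra ℂ A] [Fintype σ]
    (e : A ≃ₐ[ℂ] MvPolynomial σ ℂ) {p : A} (hp : Prime p) {L : Type*} [Field L] [Algebra ℂ L]
    (φ : (A ⧸ Ideal.span {p}) →ₐ[ℂ] L) (hφ : Function.Injective φ) {T : Finset L}
    (hT : ∀ l, IsAlgebraic (IntermediateField.adjoin ℂ (T : Set L))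
      (φ (Ideal.Quotient.mk _ (e.symm (X l))))) : Fintype.card σ ≤ T.card + 1 := by
  classical
  obtain ⟨m, hm⟩ := exists_algebraicIndependent_of_prime e hp
  have h1 := card_le_encard (hm.map' hφ) (s := T) fun l => hT l
  rw [Set.encard_coe_eq_coe_finsetCard] at h1
  have h2 : Fintype.card {l : σ // l ≠ m} = Fintype.card σ - 1 := by
    simp [Fintype.card_subtype_compl]
  rw [h2] at h1
  have h3 : Fintype.card σ - 1 ≤ T.card := by exact_mod_cast h1
  omega

/-- Residue classes modulo a prime element, in the residue field. -/
def residue {A : Type*} [CommRing A] [Algebra ℂ A] (p : A) [(Ideal.span {p}).IsPrime] :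
    (A ⧸ Ideal.span {p}) →ₐ[ℂ] FractionRing (A ⧸ Ideal.span {p}) :=
  IsScalarTower.toAlgHom ℂ _ _

theorem residue_injective {A : Type*} [CommRing A] [Algebra ℂ A] (p : A)
    [(Ideal.span {p}).IsPrime] : Function.Injective (residue p) :=
  IsFractionRing.injective _ _

theorem residue_mk_eq_zero {A : Type*} [CommRing A] [Algebra ℂ A] (p : A)
    [(Ideal.span {p}).IsPrime] {a : A} : residue p (Ideal.Quotient.mk _ a) = 0 ↔ p ∣ a := by
  rw [map_eq_zero_iff _ (residue_injective p), Ideal.Quotient.eq_zero_iff_mem,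
    Ideal.mem_span_singleton]

/-- The minors of `r` independent sections have no common factor. -/
theorem exists_not_dvd_minorForm {k r : ℕ} {v : Fin r → Fin (r + 1 + k + 1) → ℂ}
    (hv : LinearIndependent ℂ v) {p : MvPolynomial (Fin (r + 1 + 1)) ℂ} (hp : Prime p) :
    ∃ w, ¬ p ∣ minorForm X v w := by
  classical
  by_contra! h
  have : (Ideal.span {p}).IsPrime := (Ideal.span_singleton_prime hp.ne_zero).2 hp
  let φ := (residue p).comp (Ideal.Quotient.mkₐ ℂ (Ideal.span {p}))
  have hφ : ∀ a, φ a = 0 ↔ p ∣ a := fun a => residue_mk_eq_zero p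
  obtain ⟨i, hi⟩ : ∃ i, φ (X i) ≠ 0 := by
    by_contra! h0
    have h1 := (hφ _).1 (h0 ⟨0, by omega⟩)
    have h2 := (hφ _).1 (h0 ⟨1, by omega⟩)
    have h3 : Associated p (X ⟨0, by omega⟩) :=
      hp.irreducible.associated_of_dvd X_prime.irreducible h1
    exact not_X_dvd_X (by simp) (h3.symm.dvd.trans h2)
  obtain ⟨T, hT, h1⟩ := exists_isAlgebraic_of_minorForm hv φ (fun w => (hφ _).2 (h w)) hi
  let L := FractionRing (MvPolynomial (Fin (r + 1 + 1)) ℂ ⧸ Ideal.span {p})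
  -- `T` controls only the ratios of the coordinates. On the affine cone one more element, the scale
  -- `x_i`, is needed; the count still contradicts `r + 2` variables.
  let T' : Finset L := insert (φ (X i)) T
  have h2 := card_le_of_prime (AlgEquiv.refl) hp (residue p) (residue_injective p)
    (T := T') fun l => by
      have h3 : φ (X l) = φ (X l) / φ (X i) * φ (X i) := (div_mul_cancel₀ _ hi).symm
      change IsAlgebraic _ (φ (X l))
      rw [h3]
      have hle : IntermediateField.adjoin ℂ (T : Set L) ≤
          IntermediateField.adjoin ℂ (T' : Set L) :=
        IntermediateField.adjoin.mono _ _ _ (by simp [T'])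
      refine IsAlgebraic.mul ?_ ?_
      · let := (IntermediateField.inclusion hle).toRingHom.toAlgebra
        have : IsScalarTower (IntermediateField.adjoin ℂ (T : Set L))
          (IntermediateField.adjoin ℂ (T' : Set L))
          (FractionRing (MvPolynomial (Fin (r + 1 + 1)) ℂ ⧸ Ideal.span {p})) :=
          IsScalarTower.of_algebraMap_eq fun _ => rfl
        exact (h1 l).tower_top _
      · exact isAlgebraic_algebraMap (⟨φ (X i), IntermediateField.subset_adjoin ℂ _
          (Finset.mem_coe.2 (Finset.mem_insert_self _ _))⟩ : IntermediateField.adjoin ℂ (T' : Set L))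
  have h3 : T'.card ≤ _ := Finset.card_insert_le (φ (X i)) T
  simp only [Fintype.card_fin] at h2
  omega

/-- The minors of `r` independent sections have no common factor on a chart. -/
theorem exists_not_dvd_minorForm_ratio {k r : ℕ} {v : Fin r → Fin (r + 1 + k + 1) → ℂ}
    (hv : LinearIndependent ℂ v) (i : Fin (r + 1 + 1)) {p : Chart (r + 1) i} (hp : Prime p) :
    ∃ w, ¬ p ∣ minorForm (ratio (r + 1) i) v w := by
  classical
  by_contra! h
  have : (Ideal.span {p}).IsPrime := (Ideal.span_singleton_prime hp.ne_zero).2 hp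
  let φ := (residue p).comp (Ideal.Quotient.mkₐ ℂ (Ideal.span {p}))
  have hφ : ∀ a, φ a = 0 ↔ p ∣ a := fun a => residue_mk_eq_zero p
  have hi : φ (ratio (r + 1) i i) = 1 := by rw [ratio_self, map_one]
  obtain ⟨T, hT, h1⟩ := exists_isAlgebraic_of_minorForm hv φ (fun w => (hφ _).2 (h w))
    (i := i) (by rw [hi]; exact one_ne_zero)
  have h2 := card_le_of_prime (chartEquiv i) hp (residue p) (residue_injective p)
    (T := T) fun l => by
      have h3 := h1 l
      rw [hi, div_one] at h3
      rw [chartEquiv_symm_X]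
      exact h3
  have h3 : Fintype.card {m : Fin (r + 1 + 1) // m ≠ i} = r + 1 := by
    simp [Fintype.card_subtype_compl]
  omega

/-- In a factorial domain a prime of height one is generated by a prime element, which would divide
all of `I`. -/
theorem two_le_height {A : Type*} [CommRing A] [IsDomain A] [IsNoetherianRing A]
    [UniqueFactorizationMonoid A] {I : Ideal A} (hI0 : I ≠ ⊥)
    (hI : ∀ p, Prime p → ∃ a ∈ I, ¬ p ∣ a) : 2 ≤ I.height := by
  rw [Ideal.height_eq_inf_minimalPrimes]
  refine le_iInf₂ fun J hJ => ?_
  have : J.IsPrime := hJ.1.1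
  have hle : I ≤ J := hJ.1.2
  have hJ0 : J ≠ ⊥ := fun h => hI0 (le_bot_iff.1 (h ▸ hle))
  by_contra! hlt
  have h1 : J.height = 1 := by
    refine le_antisymm (Order.le_of_lt_add_one (by simpa [one_add_one_eq_two] using hlt)) ?_
    rw [Order.one_le_iff_pos, pos_iff_ne_zero, Ne, Ideal.height_eq_zero_iff_eq_bot]
    exact hJ0
  obtain ⟨x, hx, hxp⟩ := Ideal.IsPrime.exists_mem_prime_of_ne_bot ‹J.IsPrime› hJ0
  obtain ⟨a, ha, hxa⟩ := hI x hxp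
  have h2 := hle ha
  rw [Ideal.eq_span_singleton_of_height_eq_one h1 hx hxp, Ideal.mem_span_singleton] at h2
  exact hxa h2

instance isNoetherianRingChart {n : ℕ} (i : Fin (n + 1)) : IsNoetherianRing (Chart n i) :=
  isNoetherianRing_of_ringEquiv _ (chartEquiv i).symm.toRingEquiv

theorem two_le_codim {k r : ℕ} {v : Fin r → Fin (r + 1 + k + 1) → ℂ}
    (hv : LinearIndependent ℂ v) :
    2 ≤ (degeneracyScheme (r + 1) k r fun a => constSection (r + 1) k (v a)).codim := by
  refine le_iInf fun i => ?_
  rw [degeneracyScheme_ideal_eq_range]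
  have h1 : ∀ p, Prime p → ∃ a ∈ LinearMap.range (minorForm (ratio (r + 1) i) v), ¬ p ∣ a :=
    fun p hp => by
      obtain ⟨w, hw⟩ := exists_not_dvd_minorForm_ratio hv i hp
      exact ⟨_, ⟨w, rfl⟩, hw⟩
  refine two_le_height (fun h0 => ?_) h1
  have : Nontrivial (Fin (r + 1 + 1)) := Fin.nontrivial_iff_two_le.2 (by omega)
  obtain ⟨m, hm⟩ := exists_ne i
  -- An affine coordinate is a prime element, and something it does not divide is nonzero; this
  -- excludes the zero ideal.
  obtain ⟨a, ha, hpa⟩ := h1 ((chartEquiv i).symm (X ⟨m, hm⟩))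
    ((MulEquiv.prime_iff (chartEquiv i).symm.toMulEquiv).2 X_prime)
  rw [h0] at ha
  exact hpa ((Ideal.mem_bot.1 ha).symm ▸ dvd_zero _)

theorem trdeg_chart {n : ℕ} (i : Fin (n + 1)) : Algebra.trdeg ℂ (Chart n i) = n := by
  rw [(chartEquiv i).trdeg_eq, MvPolynomial.trdeg_of_isDomain]
  simp [Fintype.card_subtype_compl]

/-- Among the coordinates of the point `ρ` one finds `d` independent ones, so `add_le_trdeg` applies
to the kernel. -/
theorem height_ker_le {n d : ℕ} {i : Fin (n + 1)} {K : Type} [Field K] [Algebra ℂ K]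
    (ρ : Chart n i →ₐ[ℂ] K) {t : Fin d → K} (ht : AlgebraicIndependent ℂ t)
    (halg : ∀ j, IsAlgebraic
      (IntermediateField.adjoin ℂ (Set.range fun m => ρ (ratio n i m))) (t j)) :
    (RingHom.ker ρ).height + d ≤ n := by
  obtain ⟨τ, hτ⟩ := exists_algebraicIndependent_comp ht halg
  have : (RingHom.ker ρ).IsPrime := RingHom.ker_isPrime ρ
  have h1 : AlgebraicIndependent ℂ fun j =>
      Ideal.Quotient.mk (RingHom.ker ρ) (ratio n i (τ j)) :=
    AlgebraicIndependent.of_comp (Ideal.kerLiftAlg ρ) hτ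
  have h2 : ∀ m : ℕ, (m : ℕ∞) ≤ (RingHom.ker ρ).height → m + d ≤ n := fun m hm => by
    have := add_le_trdeg m _ _ _ h1 hm
    rw [trdeg_chart, Fintype.card_fin] at this
    have : d + m ≤ n := by exact_mod_cast this
    omega
  cases h : (RingHom.ker ρ).height with
  | top =>
    have := h2 (n + 1) (by rw [h]; exact le_top)
    omega
  | coe m =>
    exact_mod_cast h2 m h.ge

/-- A point of the locus with values in the algebraic closure of `ℂ(t₁, …, t_d)` is exhibited: a
form vanishing at the generic points `t_j`. Its kernel is a prime of height at most 2 that contains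
the ideal of the locus. -/
theorem codim_le_two {k d : ℕ} {v : Fin (d + 1) → Fin (d + 1 + 1 + k + 1) → ℂ}
    (hv : LinearIndependent ℂ v) :
    (degeneracyScheme (d + 1 + 1) k (d + 1) fun a => constSection (d + 1 + 1) k (v a)).codim ≤ 2 := by
  classical
  let K := AlgebraicClosure (FractionRing (MvPolynomial (Fin d) ℂ))
  let t : Fin d → K := fun j => algebraMap (MvPolynomial (Fin d) ℂ) K (X j)
  have ht : AlgebraicIndependent ℂ t :=
    (MvPolynomial.algebraicIndependent_X (Fin d) ℂ).map'
      (f := IsScalarTower.toAlgHom ℂ (MvPolynomial (Fin d) ℂ) K)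
      ((FaithfulSMul.algebraMap_injective (FractionRing (MvPolynomial (Fin d) ℂ)) K).comp
        (IsFractionRing.injective (MvPolynomial (Fin d) ℂ) _))
  obtain ⟨x, c, hx, hc, hxc, hroot⟩ := exists_form_vanishing d k ht.injective
    ((linearIndependent_algebraMap_comp_iff (S := K)).2 hv)
  obtain ⟨i, hi⟩ := Function.ne_iff.1 hx
  rw [Pi.zero_apply] at hi
  let y : Fin (d + 2 + 1) → K := fun m => x m / x i
  have hy : y i = 1 := div_self hi
  let ρ : Chart (d + 2) i →ₐ[ℂ] K := 
    (aeval fun m : {m : Fin (d + 2 + 1) // m ≠ i} => y m).comp (chartEquiv i).toAlgHom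
  have hρ : ρ ∘ ratio (d + 2) i = y := by
    ext m
    by_cases hm : m = i
    · rw [hm, hy, Function.comp_apply, ratio_self, map_one]
    · have h1 : ratio (d + 2) i m = (chartEquiv i).symm (X ⟨m, hm⟩) :=
        (chartEquiv_symm_X i ⟨m, hm⟩).symm
      simp [ρ, h1]
  have hxy : multMatrix (d + 2) k x = x i • multMatrix (d + 2) k y := by
    have := multMatrix_map (d + 2) k x y (RingHom.id K) (x i) fun j =>
      show x j = x i * (x j / x i) by rw [mul_comm, div_mul_cancel₀ _ hi]
    simpa using this
  have hker : (degeneracyScheme (d + 1 + 1) k (d + 1)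
      fun a => constSection (d + 1 + 1) k (v a)).ideal i ≤ RingHom.ker ρ := by
    rw [degeneracyScheme_ideal_eq_range]
    rintro _ ⟨w, rfl⟩
    rw [RingHom.mem_ker, map_minorForm, hρ]
    refine colDet_eq_zero_of_mulVec_eq_zero _ _
      (c := Sum.elim (fun l => x i * c (Sum.inl l)) fun a => c (Sum.inr a)) (fun h0 => hc ?_) ?_ _
    · ext (l | a)
      · have := congrFun h0 (Sum.inl l)
        simpa [hi] using this
      · exact congrFun h0 (Sum.inr a)
    · rw [constBordered, bordered_mulVec]
      rw [bordered_mulVec, hxy, Matrix.smul_mulVec, ← Matrix.mulVec_smul] at hxc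
      exact hxc
  -- Each `t_j` is a root of the form with coefficients `y`, hence algebraic over the coordinates of
  -- the point.
  have halg : ∀ j, IsAlgebraic
      (IntermediateField.adjoin ℂ (Set.range fun m => ρ (ratio (d + 2) i m))) (t j) := fun j => by
    have hmem : ∀ m, y m ∈ IntermediateField.adjoin ℂ
        (Set.range fun m => ρ (ratio (d + 2) i m)) := fun m =>
      IntermediateField.subset_adjoin ℂ _ ⟨m, congrFun hρ m⟩
    let yE := fun m => (⟨y m, hmem m⟩ : IntermediateField.adjoin ℂ
        (Set.range fun m => ρ (ratio (d + 2) i m)))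
    refine ⟨Polynomial.ofFn (d + 2 + 1) yE, ofFn_ne_zero fun h0 => ?_, ?_⟩
    · have := congrArg Subtype.val (congrFun h0 i)
      exact one_ne_zero (hy.symm.trans this)
    · rw [← Polynomial.eval_map_algebraMap, ofFn_map]
      have h1 : (algebraMap _ K) ∘ yE = (x i)⁻¹ • x := by
        ext m
        exact div_eq_inv_mul _ _
      rw [h1, map_smul, Polynomial.eval_smul, hroot, smul_zero]
  have h1 := height_ker_le ρ ht halg
  have h2 : (RingHom.ker ρ).height ≤ 2 := by
    have h3 : (RingHom.ker ρ).height + d ≤ 2 + d := by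
      rw [add_comm (2 : ℕ∞)]
      exact_mod_cast h1
    exact (ENat.add_le_add_iff_right (ENat.natCast_ne_top d)).1 h3
  exact (iInf_le _ i).trans ((Ideal.height_mono hker).trans h2)

end Codimension

/-! ### Determinants of `n` sections, and saturation of the ideal of minors. -/

section Determinants

open MvPolynomial

/-- Separating the last of the bordering columns. -/
def lastColumnEquiv (r k : ℕ) : Fin (k + 1) ⊕ Fin (r + 1) ≃ Option (Fin (k + 1) ⊕ Fin r) where
  toFun := Sum.elim (fun l => some (Sum.inl l))
    fun a => Fin.lastCases none (fun b => some (Sum.inr b)) a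
  invFun b := b.elim (Sum.inr (Fin.last r)) (Sum.map id Fin.castSucc)
  left_inv := by
    rintro (l | a)
    · rfl
    · induction a using Fin.lastCases <;> simp
  right_inv := by
    rintro (_ | l | a) <;> simp

theorem constBordered_succ {A : Type*} [CommRing A] [Algebra ℂ A] {n k r : ℕ}
    (x : Fin (n + 1) → A) (v : Fin (r + 1) → Fin (n + k + 1) → ℂ) :
    constBordered x v =
      (withCol (constBordered x fun a => v a.castSucc) (algebraMap ℂ A ∘ v (Fin.last r))).submatrix
        id (lastColumnEquiv r k) := by
  ext i (l | a)
  · rfl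
  · induction a using Fin.lastCases with
    | last => simp [constBordered, bordered, withCol, lastColumnEquiv]
    | cast a => simp [constBordered, bordered, withCol, lastColumnEquiv]

theorem det_constBordered_succ {A : Type*} [CommRing A] [Algebra ℂ A] {n k r : ℕ}
    (x : Fin (n + 1) → A) (v : Fin (r + 1) → Fin (n + k + 1) → ℂ)
    (e : Fin (k + 1) ⊕ Fin (r + 1) → Fin (n + k + 1)) :
    ((constBordered x v).submatrix e id).det =
      ((withCol (constBordered x fun a => v a.castSucc)
        (algebraMap ℂ A ∘ v (Fin.last r))).submatrix (e ∘ (lastColumnEquiv r k).symm) id).det := by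
  rw [constBordered_succ, ← Matrix.det_submatrix_equiv_self (lastColumnEquiv r k).symm]
  congr 1
  ext a b
  simp

/-- Omitting a section enlarges the degeneracy scheme's ideals. -/
theorem degeneracyScheme_succ_le {n k r : ℕ} (v : Fin (r + 1) → Fin (n + k + 1) → ℂ)
    (i : Fin (n + 1)) :
    (degeneracyScheme n k (r + 1) fun a => constSection n k (v a)).ideal i ≤
      (degeneracyScheme n k r fun a => constSection n k (v a.castSucc)).ideal i := by
  rw [degeneracyScheme_constSection_ideal, degeneracyScheme_constSection_ideal, Ideal.span_le]
  rintro _ ⟨e, rfl⟩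
  rw [det_constBordered_succ]
  exact det_withCol_mem_span _ _ _

/-- Selecting rows of a square matrix multiplies its determinant by a scalar. -/
theorem det_submatrix_rows {A ι : Type*} [CommRing A] [Fintype ι] [DecidableEq ι]
    (M : Matrix ι ι A) (g : ι → ι) :
    (M.submatrix g id).det = ((1 : Matrix ι ι A).submatrix g id).det * M.det := by
  rw [← Matrix.det_mul]
  congr 1
  ext a b
  simp [Matrix.mul_apply, Matrix.one_apply]

/-- The degeneracy scheme of `r + 1` sections of the bundle of rank `r + 1` is given by the
determinant. -/
theorem degeneracyScheme_ideal_eq_span {k r : ℕ} (v : Fin (r + 1) → Fin (r + 1 + k + 1) → ℂ)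
    (i : Fin (r + 1 + 1)) :
    (degeneracyScheme (r + 1) k (r + 1) fun a => constSection (r + 1) k (v a)).ideal i =
      Ideal.span {minorForm (ratio (r + 1) i) (fun a => v a.castSucc)
        (algebraMap ℂ _ ∘ v (Fin.last r))} := by
  rw [degeneracyScheme_constSection_ideal]
  refine le_antisymm (Ideal.span_le.2 ?_) (Ideal.span_le.2 ?_)
  · rintro _ ⟨e, rfl⟩
    rw [det_constBordered_succ, SetLike.mem_coe, Ideal.mem_span_singleton, minorForm, colDet_apply]
    set M := withCol (constBordered (ratio (r + 1) i) fun a => v a.castSucc)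
      (algebraMap ℂ _ ∘ v (Fin.last r))
    -- Every choice of rows factors through the full square matrix, so each minor is a multiple of
    -- the one determinant.
    have h1 := det_submatrix_rows (M.submatrix (rowEquiv r k) id)
      ((rowEquiv r k).symm ∘ e ∘ (lastColumnEquiv r k).symm)
    have h2 : (M.submatrix (rowEquiv r k) id).submatrix
        ((rowEquiv r k).symm ∘ e ∘ (lastColumnEquiv r k).symm) id =
          M.submatrix (e ∘ (lastColumnEquiv r k).symm) id := by
      ext a b
      simp
    rw [← h2, h1]
    exact dvd_mul_left _ _
  · rw [Set.singleton_subset_iff]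
    refine Ideal.subset_span ⟨rowEquiv r k ∘ lastColumnEquiv r k, ?_⟩
    rw [det_constBordered_succ, minorForm, colDet_apply]
    congr 1
    ext a b
    simp

theorem minorForm_isHomogeneous {k r N : ℕ} (v : Fin r → Fin (r + 1 + k + 1) → ℂ)
    {w : Fin (r + 1 + k + 1) → MvPolynomial (Fin (r + 1 + 1)) ℂ}
    (hw : ∀ m, (w m).IsHomogeneous N) : (minorForm X v w).IsHomogeneous (N + (k + 1)) := by
  rw [minorForm, colDet_apply, Matrix.det_apply]
  refine IsHomogeneous.sum _ _ _ fun τ _ => ?_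
  let deg : Option (Fin (k + 1) ⊕ Fin r) → ℕ := fun b =>
    b.elim N (Sum.elim (fun _ => 1) fun _ => 0)
  have h1 : ∑ b, deg b = N + (k + 1) := by
    simp [Fintype.sum_option, deg]
  have h2 : (∏ b, (withCol (constBordered X v) w).submatrix (rowEquiv r k) id (τ b) b).IsHomogeneous
      (∑ b, deg b) := by
    refine IsHomogeneous.prod _ _ _ fun b _ => ?_
    rcases b with _ | l | a
    · exact hw _
    · exact multMatrix_isHomogeneous _ _
    · exact isHomogeneous_C _ _
  rw [h1] at h2
  rw [Units.smul_def, ← mem_homogeneousSubmodule]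
  exact zsmul_mem h2 _

theorem minorForm_mulVec {A : Type*} [CommRing A] [IsDomain A] [Algebra ℂ A] {k r : ℕ}
    (x : Fin (r + 1 + 1) → A) (v : Fin r → Fin (r + 1 + k + 1) → ℂ)
    (c : Fin (k + 1) ⊕ Fin r → A) : minorForm x v ((constBordered x v).mulVec c) = 0 := by
  rw [minorForm, colDet_apply, ← Matrix.exists_mulVec_eq_zero_iff]
  refine ⟨fun b => b.elim 1 (-c), fun h => one_ne_zero (congrFun h none), ?_⟩
  ext a
  rw [submatrix_withCol_mulVec]
  have : (fun l => Option.elim (some l) (1 : A) (-c)) = -c := rfl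
  rw [this, Matrix.mulVec_neg]
  simp

/-- A form which vanishes on the degeneracy scheme of `r` independent sections of the bundle of
rank `r + 1` is a determinant: the ideal of the minors is saturated. -/
theorem exists_eq_minorForm {k r : ℕ} (hr : 1 ≤ r) {v : Fin r → Fin (r + 1 + k + 1) → ℂ}
    (hv : LinearIndependent ℂ v) {F : MvPolynomial (Fin (r + 1 + 1)) ℂ}
    (hF : F.IsHomogeneous (k + 1))
    (h : ∀ i, toChart i F ∈ LinearMap.range (minorForm (ratio (r + 1) i) v)) :
    ∃ c : Fin (r + 1 + k + 1) → ℂ, F = minorForm X v (C ∘ c) := by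
  choose w hw using h
  choose N₀ hN₀ using fun i => exists_toChart_eq i (w i)
  let N := Finset.univ.sup N₀
  choose A hA using fun i => hN₀ i N (Finset.le_sup (f := N₀) (Finset.mem_univ i))
  -- Both sides are forms of degree `N + k + 1`, so equality may be checked after dehomogenizing at
  -- `x_i`.
  have h1 : ∀ i, minorForm X v (A i) = X i ^ N * F := fun i => by
    rw [← sub_eq_zero, ← toChart_eq_zero_iff (d := N + (k + 1)) _ i]
    · rw [map_sub, map_mul, map_pow, toChart_X, ratio_self, one_pow, one_mul, ← hw i,
        map_minorForm, sub_eq_zero]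
      have h2 : toChart i ∘ (X : Fin (r + 1 + 1) → _) = ratio (r + 1) i := funext (toChart_X i)
      have h3 : toChart i ∘ A i = w i := funext fun m => (hA i m).2
      rw [h2, h3]
    · refine (minorForm_isHomogeneous v fun m => (hA i m).1).sub (IsHomogeneous.mul ?_ hF)
      simpa using (isHomogeneous_X ℂ i).pow N
  -- Both terms have determinant `x_i^N x_j^N F`, so the difference is a syzygy of the minors.
  have h2 : ∀ i j, (X j ^ N : MvPolynomial (Fin (r + 1 + 1)) ℂ) • A i -
      (X i ^ N : MvPolynomial (Fin (r + 1 + 1)) ℂ) • A j ∈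
        LinearMap.range (constBordered X v).mulVecLin := fun i j => by
    refine mem_range_of_colDet_eq_zero _ (rowEquiv r k)
      (fun p hp => exists_not_dvd_minorForm hv hp) ?_ ?_
    · obtain ⟨u, hu⟩ := exists_not_dvd_minorForm hv (X_prime (i := i))
      exact ⟨u, fun h0 => hu (h0.symm ▸ dvd_zero _)⟩
    · rw [map_sub, map_smul, map_smul, h1, h1]
      simp only [smul_eq_mul]
      ring
  let i₀ : Fin (r + 1 + 1) := ⟨0, by omega⟩
  let i₁ : Fin (r + 1 + 1) := ⟨1, by omega⟩
  let i₂ : Fin (r + 1 + 1) := ⟨2, by omega⟩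
  have h01 : i₁ ≠ i₀ := by simp [i₀, i₁]
  have h02 : i₀ ≠ i₂ := by simp [i₀, i₂]
  have h12 : i₁ ≠ i₂ := by simp [i₁, i₂]
  obtain ⟨u, hu⟩ := exists_not_dvd_minorForm hv (X_prime (i := i₀))
  obtain ⟨B, c, hB⟩ := exists_eq_smul_add_of_cocycle (N := constBordered X v)
    (fun c hc => by
      by_contra hc0
      exact hu (colDet_eq_zero_of_mulVec_eq_zero _ (rowEquiv r k) hc0 hc u ▸ dvd_zero _))
    (fun b => X_pow_dvd_of_dvd_X_pow_mul h01 N) (fun b => mem_span_of_X_pow_mul_mem h02 h12 N)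
    (h2 i₀ i₁) (h2 i₀ i₂) (h2 i₁ i₂)
  have h3 : F = minorForm X v B := by
    have h4 := h1 i₀
    rw [hB, map_add, map_smul, minorForm_mulVec, add_zero, smul_eq_mul] at h4
    exact (mul_left_cancel₀ (pow_ne_zero N (X_ne_zero i₀)) h4).symm
  -- The minors and `F` have the same degree `k + 1`, so only the constant parts of `B` contribute
  -- to `F`.
  refine ⟨fun m => coeff 0 (B m), ?_⟩
  have h4 : ∀ m, (minorForm X v (Pi.single m 1) : MvPolynomial (Fin (r + 1 + 1)) ℂ).IsHomogeneous
      (k + 1) := fun m => by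
    have := minorForm_isHomogeneous (N := 0) v
      (w := (Pi.single m 1 : Fin (r + 1 + k + 1) → MvPolynomial (Fin (r + 1 + 1)) ℂ)) fun m' => by
        by_cases hm : m' = m
        · subst hm
          simpa using isHomogeneous_one _ _
        · simpa [hm] using isHomogeneous_zero _ _ _
    rwa [zero_add] at this
  have h5 : ∀ w : Fin (r + 1 + k + 1) → MvPolynomial (Fin (r + 1 + 1)) ℂ,
      minorForm X v w = ∑ m, minorForm X v (Pi.single m 1) * w m := fun w => by
    rw [LinearMap.pi_apply_eq_sum_univ (minorForm X v) w]
    refine Finset.sum_congr rfl fun m _ => ?_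
    rw [smul_eq_mul, mul_comm]
    congr 2
    ext1 m'
    simp [Pi.single_apply, eq_comm]
  have h6 : homogeneousComponent (k + 1) F = F := homogeneousComponent_eq_self hF
  rw [← h6, h3, h5, h5, map_sum]
  refine Finset.sum_congr rfl fun m _ => ?_
  rw [Function.comp_apply, ← homogeneousComponent_zero]
  exact homogeneousComponent_mul_of_isHomogeneous (b := 0) (h4 m)

/-- Sections with a nonzero determinant are independent. -/
theorem linearIndependent_constSection {k r : ℕ} {v : Fin (r + 1) → Fin (r + 1 + k + 1) → ℂ}
    {i : Fin (r + 1 + 1)} (h : minorForm (ratio (r + 1) i) (fun a => v a.castSucc)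
      (algebraMap ℂ _ ∘ v (Fin.last r)) ≠ 0) :
    LinearIndependent ℂ fun a => constSection (r + 1) k (v a) := by
  rw [Fintype.linearIndependent_iffₛ]
  intro f g hfg
  have h1 : constSection (r + 1) k (∑ j, f j • v j) = constSection (r + 1) k (∑ j, g j • v j) := by
    rw [map_sum, map_sum]
    simp only [map_smul]
    exact hfg
  have h2 : (Submodule.Quotient.mk fun m => algebraMap ℂ (Chart (r + 1) i) ((∑ j, f j • v j) m) :
      ChartSections (r + 1) k i) =
        Submodule.Quotient.mk fun m => algebraMap ℂ (Chart (r + 1) i) ((∑ j, g j • v j) m) := by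
    rw [← constSection_apply, h1, constSection_apply]
  obtain ⟨b, hb⟩ := (Submodule.Quotient.eq _).1 h2
  by_contra! hne
  obtain ⟨j, hj⟩ := hne
  -- Two distinct combinations giving the same section differ by a multiplication column: a nonzero
  -- kernel vector of the square matrix.
  have h3 : (constBordered (ratio (r + 1) i) v).mulVec
      (Sum.elim (-b) fun j => algebraMap ℂ _ (f j - g j)) = 0 := by
    rw [constBordered, bordered_mulVec]
    have h4 : (fun l => Sum.elim (-b) (fun j => algebraMap ℂ (Chart (r + 1) i) (f j - g j))
        (Sum.inl l : Fin (k + 1) ⊕ Fin (r + 1))) = -b := rfl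
    rw [h4, Matrix.mulVec_neg, ← Matrix.mulVecLin_apply, hb]
    ext m
    simp [sub_mul, Finset.sum_sub_distrib]
  refine h ?_
  rw [minorForm, colDet_apply]
  have h5 := det_constBordered_succ (ratio (r + 1) i) v (rowEquiv r k ∘ lastColumnEquiv r k)
  have h6 : (rowEquiv r k ∘ lastColumnEquiv r k) ∘ (lastColumnEquiv r k).symm = rowEquiv r k := by
    ext1 b
    simp
  rw [h6] at h5
  rw [← h5, ← Matrix.exists_mulVec_eq_zero_iff]
  refine ⟨Sum.elim (-b) fun j => algebraMap ℂ (Chart (r + 1) i) (f j - g j),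
    fun h0 => hj ?_, ?_⟩
  · have := congrFun h0 (Sum.inr j)
    refine sub_eq_zero.1 (FaithfulSMul.algebraMap_injective ℂ (Chart (r + 1) i) ?_)
    exact (this.trans (map_zero _).symm)
  · funext b'
    exact congrFun h3 _

theorem toChart_minorForm {k r : ℕ} (v : Fin r → Fin (r + 1 + k + 1) → ℂ)
    (c : Fin (r + 1 + k + 1) → ℂ) (i : Fin (r + 1 + 1)) :
    toChart i (minorForm X v (C ∘ c)) =
      minorForm (ratio (r + 1) i) v (algebraMap ℂ _ ∘ c) := by
  have h2 : toChart i ∘ (X : Fin (r + 1 + 1) → _) = ratio (r + 1) i := funext (toChart_X i)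
  have h3 : toChart i ∘ (C ∘ c) = algebraMap ℂ _ ∘ c := funext fun m => toChart_C i (c m)
  rw [map_minorForm, h2, h3]

end Determinants

end Schwarzenberger

end

/-! ### The equivalence. -/

open Schwarzenberger in
theorem proposition2p2 (n k : ℕ) (hn : 2 ≤ n) (F : MvPolynomial (Fin (n + 1)) ℂ)
    (hF : F.IsHomogeneous (k + 1)) (hF0 : F ≠ 0) :
    Schwarzenberger.IsPonceletVariety n k n (Schwarzenberger.hypersurface F hF) ↔
      ∃ X : Schwarzenberger.ClosedSubscheme n,
        Schwarzenberger.IsPonceletVariety n k (n - 1) X ∧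
        X.codim = 2 ∧
        (Schwarzenberger.hypersurface F hF).Contains X := by
  obtain ⟨d, rfl⟩ : ∃ d, n = d + 1 + 1 := ⟨n - 2, by omega⟩
  constructor
  · rintro ⟨-, s, hs, hZ⟩
    choose v hv using fun a => constSection_surjective (k := k) hn (s a)
    obtain rfl : (fun a => constSection (d + 1 + 1) k (v a)) = s := funext hv
    have h1 : LinearIndependent ℂ fun a : Fin (d + 1) =>
        constSection (d + 1 + 1) k (v a.castSucc) := hs.comp _ (Fin.castSucc_injective _)
    have h2 : LinearIndependent ℂ fun a : Fin (d + 1) => v a.castSucc :=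
      LinearIndependent.of_comp (constSection (d + 1 + 1) k) h1
    refine ⟨_, ⟨Nat.sub_le _ _, _, h1, rfl⟩, le_antisymm (codim_le_two h2) (two_le_codim h2), ?_⟩
    rw [hZ]
    exact degeneracyScheme_succ_le v
  · rintro ⟨Y, ⟨-, s, hs, rfl⟩, -, hY⟩
    change Fin (d + 1) → _ at s
    choose v hv using fun a => constSection_surjective (k := k) hn (s a)
    obtain rfl : (fun a => constSection (d + 1 + 1) k (v a)) = s := funext hv
    have h1 : LinearIndependent ℂ v := LinearIndependent.of_comp (constSection (d + 1 + 1) k) hs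
    obtain ⟨c, hc⟩ := exists_eq_minorForm (by omega) h1 hF fun i => by
      rw [toChart_eq_dehom F hF i, ← degeneracyScheme_ideal_eq_range]
      have h0 : dehom F hF i ∈ (hypersurface F hF).ideal i := Ideal.mem_span_singleton_self _
      exact hY i h0
    -- The constant column `c` is the missing last section; on every chart the determinant is then
    -- exactly the equation of the hypersurface.
    let v' : Fin (d + 1 + 1) → Fin (d + 1 + 1 + k + 1) → ℂ := Fin.snoc v c
    have h2 : ∀ i, minorForm (ratio (d + 1 + 1) i) (fun a => v' a.castSucc)
        (algebraMap ℂ _ ∘ v' (Fin.last (d + 1))) = dehom F hF i := fun i => by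
      have h3 : (fun a : Fin (d + 1) => v' a.castSucc) = v := by
        ext1 a
        simp [v']
      have h4 : v' (Fin.last (d + 1)) = c := by simp [v']
      rw [h3, h4, ← toChart_minorForm, ← hc, toChart_eq_dehom F hF i]
    refine ⟨le_rfl, _, linearIndependent_constSection (v := v') (i := 0) ?_, ?_⟩
    · rw [h2, ← toChart_eq_dehom F hF, Ne, toChart_eq_zero_iff hF]
      exact hF0
    · ext1
      ext1 i
      rw [degeneracyScheme_ideal_eq_span, h2]
      rfl
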